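/- Let $a$ be a positive integer, let $G$ be a finite abelian group of exponent dividing $a$, and let $\varepsilon > 0$. Then there are constants $K, c > 0$ (depending only on $a$, $G$ and $\varepsilon$) such that the following holds for every $n$. Write $R = \mathbb Z/a\mathbb Z$. Let $C$ be a deterministic alternating $n\times n$ matrix over $R$ (that is, $C^{\intercal} = -C$ and $C$ has zero diagonal). An $n \times n$ matrix $M$ over $R$ is called $C$-symmetric if $M - M^{\intercal} = C$. A homomorphism $F\colon R^n \to G$ is called isotropic for $C$ if there is a $C$-symmetric matrix $M$ with $F\circ M = 0$. An $R$-valued random variable $N$ is called $\varepsilon$-balanced if $\mathbb P[N \equiv r \pmod{\mathfrak p}] \le 1-\varepsilon$ for every maximal ideal $\mathfrak p$ of $R$ and every $r \in R/\mathfrak p$. Let $X$ be a random $C$-symmetric $n\times n$ matrix over $R$ whose entries on and above the diagonal are independent and $\varepsilon$-balanced, let $\operatorname{coker}(X) = R^n/X R^n$, and let $\widetilde F$ be a uniformly random homomorphism $R^n \to G$. Then \[ \left|\mathbb E[\#\operatorname{Sur}(\operatorname{coker}(X), G)] - |\wedge^2 G|\cdot\mathbb P[\widetilde F\text{ is isotropic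 for }C]\right| \le K e^{-cn}, \] where $\operatorname{Sur}(A, G)$ denotes the set of surjective group homomorphisms $A \to G$. -/

import Mathlib

open MeasureTheory ProbabilityTheory

namespace RandomCokernel

/-- A square matrix is alternating if it is antisymmetric with zero diagonal. -/
def IsAlternating {R : Type*} [CommRing R] {n : ℕ} (C : Matrix (Fin n) (Fin n) R) : Prop :=
  C.transpose = -C ∧ ∀ i, C i i = 0

/-- `X` is `C`-symmetric if `X - Xᵀ = C`. -/
def IsCSymmetric {R : Type*} [CommRing R] {n : ℕ} (C X : Matrix (Fin n) (Fin n) R) : Prop :=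
  X - X.transpose = C

/-- A random variable `N` with values in the ring `R` is `ε`-balanced if it lies in any given
residue class modulo any given maximal ideal of `R` with probability at most `1 - ε`. -/
def IsBalanced {R : Type*} [CommRing R] {Ω : Type*} [MeasurableSpace Ω] (P : Measure Ω)
    (ε : ℝ) (N : Ω → R) : Prop :=
  ∀ 𝔭 : Ideal R, 𝔭.IsMaximal → ∀ r : R ⧸ 𝔭, P.real {ω | Ideal.Quotient.mk 𝔭 (N ω) = r} ≤ 1 - ε

/-- The cokernel `Rⁿ / M(Rⁿ)` of a square matrix `M` (acting on column vectors). -/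
abbrev Coker {R : Type*} [CommRing R] {n : ℕ} (M : Matrix (Fin n) (Fin n) R) : Type _ :=
  (Fin n → R) ⧸ LinearMap.range M.mulVecLin

/-- The number of surjective group homomorphisms from `A` onto `G`. -/
noncomputable def numSur (A G : Type*) [AddCommGroup A] [AddCommGroup G] : ℕ :=
  Nat.card {f : A →+ G // Function.Surjective f}

/-- `F : Rⁿ → G` is isotropic for `C` if `F ∘ M = 0` for some `C`-symmetric matrix `M`. -/
def IsIsotropic {R : Type*} [CommRing R] {n : ℕ} {G : Type*} [AddCommGroup G]
    (C : Matrix (Fin n) (Fin n) R) (F : (Fin n → R) →+ G) : Prop :=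
  ∃ M : Matrix (Fin n) (Fin n) R, IsCSymmetric C M ∧ F.comp M.mulVecLin.toAddMonoidHom = 0

/-- The uniform distribution on the set of homomorphisms `Rⁿ → G`
(with the σ-algebra of all subsets). -/
noncomputable def uniformHom (R : Type*) [CommRing R] (n : ℕ) (G : Type*) [AddCommGroup G] :
    @Measure ((Fin n → R) →+ G) ⊤ :=
  letI : MeasurableSpace ((Fin n → R) →+ G) := ⊤
  uniformOn Set.univ

/-- The probability that a uniformly random homomorphism `Rⁿ → G` is isotropic for `C`. -/
noncomputable def probIsotropic {R : Type*} [CommRing R] {n : ℕ} (G : Type*) [AddCommGroup G]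
    (C : Matrix (Fin n) (Fin n) R) : ℝ :=
  letI : MeasurableSpace ((Fin n → R) →+ G) := ⊤
  (uniformHom R n G).real {F | IsIsotropic C F}

end RandomCokernel

namespace RandomCokernel

open Module Finset

/-! ### Duality for finite `ℤ/a`-modules -/

section Duality

/-! A surjection from the cokernel is a surjective `F : Rⁿ → G` with `F ∘ X = 0`; encode `F` by the
images `g i` of the basis vectors. Fourier inversion on `Gⁿ` writes P[F ∘ X = 0] as |G|⁻ⁿ times a
sum, over tuples `D` of linear forms on `G`, of E ψ(∑ D_j(F X e_j)). In the free entries X_ij, i ≤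
j, this pairing is affine: the coefficients are D_j(g_i) + D_i(g_j) off the diagonal and D_i(g_i) on
it, and the constant term comes from `C`.

The `D` with all coefficients zero form a group on which the constant term defines a character,
trivial exactly when `F` is isotropic (`sum_stdAddChar_skewPart`). For surjective `F` this group is
that of the alternating forms on `G`, of order |∧²G| (`card_alternatingTuples`,
`card_alternatingMap`). Summing over `F` gives the main term, since nonsurjective `F` are
exponentially rare.

For the other `D`, each nonzero coefficient costs a factor ρ < 1. Regard (D_i, g_i) as vectors of
the hyperbolic quadratic module V = G^∨ × G, of order |G|². The cost is then governed by `weight`,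
which counts failures of orthogonality and isotropy, and `expDecay_sum_weight` bounds the total
error. Let L be the span of the values that a tuple takes often. If these values are not mutually
orthogonal, the weight is of order n². If they are, |L| ≤ |G|. When |L| < |G|, there are too few
such tuples. When |L| = |G|, L is its own orthogonal, so each entry outside L adds weight of order
n; if no entry lies outside, the form is nonzero at some frequent value, which again costs order n.
-/

lemma addChar_sum {A M ι : Type*} [AddCommMonoid A] [CommMonoid M] (ψ : AddChar A M)
    (s : Finset ι) (f : ι → A) : ψ (∑ i ∈ s, f i) = ∏ i ∈ s, ψ (f i) := by
  classical
  induction s using Finset.induction_on with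
  | empty => simp
  | insert i s hi ih => rw [sum_insert hi, prod_insert hi, AddChar.map_add_eq_mul, ih]

variable {a : ℕ} [NeZero a] {G : Type*} [AddCommGroup G] [Module (ZMod a) G]

instance finite_dual [Finite G] : Finite (Dual (ZMod a) G) := DFunLike.finite _

lemma exists_stdAddChar_eq {z : ℂ} (hz : z ^ a = 1) : ∃ k : ZMod a, ZMod.stdAddChar k = z := by
  obtain ⟨i, -, hi⟩ := (Complex.isPrimitiveRoot_exp a (NeZero.ne a)).eq_pow_of_pow_eq_one hz
  refine ⟨((i : ℤ) : ZMod a), ?_⟩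
  rw [ZMod.stdAddChar_coe, ← hi, ← Complex.exp_nat_mul]
  congr 1
  push_cast
  ring

/-- Composition of a linear form with the standard additive character of `ℤ/a`. -/
noncomputable def dualChar (f : Dual (ZMod a) G) : AddChar G ℂ :=
  ZMod.stdAddChar.compAddMonoidHom f.toAddMonoidHom

lemma dualChar_apply (f : Dual (ZMod a) G) (g : G) :
    dualChar f g = ZMod.stdAddChar (f g) := rfl

/-- Since `a` kills `G`, every complex character takes values in the `a`-th roots of unity, which
`ZMod.stdAddChar` parametrizes injectively. Character theory of `G` thus transfers to linear forms.
-/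
lemma dualChar_bijective [Finite G] :
    Function.Bijective (dualChar : Dual (ZMod a) G → AddChar G ℂ) := by
  refine ⟨fun f f' h => LinearMap.ext fun g => ZMod.injective_stdAddChar ?_, fun χ => ?_⟩
  · exact DFunLike.congr_fun h g
  · have h (g : G) : ∃ k : ZMod a, ZMod.stdAddChar k = χ g := by
      apply exists_stdAddChar_eq
      rw [← AddChar.map_nsmul_eq_pow, ZModModule.char_nsmul_eq_zero, AddChar.map_zero_eq_one]
    choose f hf using h
    refine ⟨AddMonoidHom.toZModLinearMap a (AddMonoidHom.mk' f fun x y =>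
      ZMod.injective_stdAddChar ?_), ?_⟩
    · rw [AddChar.map_add_eq_mul, hf, hf, hf, AddChar.map_add_eq_mul]
    · ext g
      exact hf g

lemma card_dual [Finite G] : Nat.card (Dual (ZMod a) G) = Nat.card G := by
  cases nonempty_fintype G
  rw [Nat.card_congr (Equiv.ofBijective _ (dualChar_bijective (a := a) (G := G))),
    Nat.card_eq_fintype_card, AddChar.card_eq, Nat.card_eq_fintype_card]

lemma exists_dual_ne_zero [Finite G] {g : G} (hg : g ≠ 0) : ∃ f : Dual (ZMod a) G, f g ≠ 0 := by
  obtain ⟨χ, hχ⟩ := AddChar.exists_apply_ne_zero.2 hg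
  obtain ⟨f, rfl⟩ := (dualChar_bijective (a := a)).surjective χ
  refine ⟨f, fun h => hχ ?_⟩
  rw [dualChar_apply, h, AddChar.map_zero_eq_one]

lemma exists_dual_separating [Finite G] (W : Submodule (ZMod a) G) {g : G} (hg : g ∉ W) :
    ∃ f : Dual (ZMod a) G, (∀ w ∈ W, f w = 0) ∧ f g ≠ 0 := by
  have : Finite (G ⧸ W) := Finite.of_surjective _ W.mkQ_surjective
  have : W.mkQ g ≠ 0 := by simpa using hg
  obtain ⟨f, hf⟩ := exists_dual_ne_zero (a := a) this
  exact ⟨f.comp W.mkQ, fun w hw => by simp [(Submodule.Quotient.mk_eq_zero W).2 hw], hf⟩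

lemma sum_stdAddChar_dual [Finite G] [Fintype (Dual (ZMod a) G)] [DecidableEq G] (g : G) :
    ∑ f : Dual (ZMod a) G, ZMod.stdAddChar (f g) = if g = 0 then (Nat.card G : ℂ) else 0 := by
  cases nonempty_fintype G
  rw [Nat.card_eq_fintype_card, ← AddChar.sum_apply_eq_ite g]
  exact Fintype.sum_bijective _ dualChar_bijective _ _ fun f => rfl

lemma sum_stdAddChar_dual_pi [Finite G] [Fintype (Dual (ZMod a) G)] [DecidableEq G] {n : ℕ}
    (g : Fin n → G) :
    ∑ D : Fin n → Dual (ZMod a) G, ZMod.stdAddChar (∑ j, D j (g j))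
      = if g = 0 then (Nat.card G : ℂ) ^ n else 0 := by
  simp_rw [addChar_sum]
  rw [← Fintype.prod_sum (fun (j : Fin n) (f : Dual (ZMod a) G) => ZMod.stdAddChar (f (g j)))]
  simp_rw [sum_stdAddChar_dual, Fintype.prod_ite_zero]
  simp [funext_iff]

end Duality

/-! ### Character sums of balanced variables -/

section CharacterBound

variable {a : ℕ} [NeZero a]

lemma exists_pos_le_one_sub_re_stdAddChar :
    ∃ κ > (0 : ℝ), ∀ t : ZMod a, t ≠ 0 → κ ≤ 1 - (ZMod.stdAddChar t).re := by
  classical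
  obtain ⟨t₀, h₀⟩ := Finite.exists_min
    fun t : ZMod a => if t = 0 then (1 : ℝ) else 1 - (ZMod.stdAddChar t).re
  refine ⟨_, ?_, fun t ht => (h₀ t).trans_eq (if_neg ht)⟩
  split_ifs with h
  · exact one_pos
  · have hn : ‖(ZMod.stdAddChar t₀ : ℂ)‖ = 1 := AddChar.norm_apply _ _
    refine sub_pos.2 (lt_of_le_of_ne (hn ▸ Complex.re_le_norm _) fun hre => h ?_)
    apply ZMod.injective_stdAddChar
    rw [AddChar.map_zero_eq_one]
    have h2 := Complex.sq_norm (ZMod.stdAddChar t₀)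
    rw [hn, Complex.normSq_apply, hre] at h2
    refine Complex.ext (by simpa using hre) ?_
    have : (ZMod.stdAddChar t₀ : ℂ).im * (ZMod.stdAddChar t₀ : ℂ).im = 0 := by linarith
    simpa using this

/-- The square is the mean of Re ψ(x - y) over two independent copies. They differ with probability
at least ε, because ∑ p(x)² ≤ 1 - ε, and then lose at least κ. -/
lemma sq_norm_sum_stdAddChar_le {κ ε : ℝ} (hκ0 : 0 < κ)
    (hκ : ∀ t : ZMod a, t ≠ 0 → κ ≤ 1 - (ZMod.stdAddChar t).re)
    (p : ZMod a → ℝ) (hp : ∀ x, 0 ≤ p x) (hsum : ∑ x, p x = 1) (hle : ∀ x, p x ≤ 1 - ε) :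
    ‖∑ x, (p x : ℂ) * ZMod.stdAddChar x‖ ^ 2 ≤ 1 - κ * ε := by
  classical
  have key : ‖∑ x, (p x : ℂ) * ZMod.stdAddChar x‖ ^ 2
      = ∑ x, ∑ y, p x * p y * (ZMod.stdAddChar (x - y)).re := by
    rw [← Complex.ofReal_re (‖_‖ ^ 2)]
    push_cast
    rw [← Complex.mul_conj', map_sum, Finset.sum_mul_sum, Complex.re_sum]
    refine Finset.sum_congr rfl fun x _ => ?_
    rw [Complex.re_sum]
    refine Finset.sum_congr rfl fun y _ => ?_
    rw [map_mul, Complex.conj_ofReal, AddChar.map_sub_eq_div, ← AddChar.map_neg_eq_conj,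
      AddChar.map_neg_eq_inv, mul_mul_mul_comm, ← Complex.ofReal_mul, Complex.re_ofReal_mul,
      div_eq_mul_inv]
  rw [key]
  calc ∑ x, ∑ y, p x * p y * (ZMod.stdAddChar (x - y)).re
      ≤ ∑ x, ∑ y, (p x * p y * (1 - κ) + if x = y then κ * (p x * (1 - ε)) else 0) := by
        refine Finset.sum_le_sum fun x _ => Finset.sum_le_sum fun y _ => ?_
        have hxy := mul_nonneg (hp x) (hp y)
        split_ifs with h
        · subst h
          rw [sub_self, AddChar.map_zero_eq_one, Complex.one_re]
          have := mul_le_mul_of_nonneg_left (hle x) (mul_nonneg hκ0.le (hp x))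
          linarith
        · have := mul_le_mul_of_nonneg_left (hκ (x - y) (sub_ne_zero.2 h)) hxy
          linarith
    _ = 1 - κ * ε := by
        simp_rw [Finset.sum_add_distrib, Finset.sum_ite_eq, Finset.mem_univ, if_true,
          ← Finset.sum_mul, ← Finset.mul_sum, ← Finset.sum_mul, hsum]
        ring

/-- The annihilator of `c ≠ 0` is a proper ideal, so it lies in some maximal 𝔭; fixing `c * N`
therefore fixes `N` modulo 𝔭. -/
lemma measureReal_mul_eq_le {Ω : Type*} [MeasurableSpace Ω] {P : Measure Ω}
    [IsProbabilityMeasure P] {ε : ℝ} {N : Ω → ZMod a} (hN : IsBalanced P ε N) {c : ZMod a}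
    (hc : c ≠ 0) (y : ZMod a) : P.real {ω | c * N ω = y} ≤ 1 - ε := by
  have htop : LinearMap.ker (LinearMap.mulLeft (ZMod a) c) ≠ (⊤ : Ideal (ZMod a)) := by
    rw [Ideal.ne_top_iff_one]
    simpa using hc
  obtain ⟨𝔭, h𝔭, hle⟩ := Ideal.exists_le_maximal _ htop
  by_cases hex : ∃ x, c * x = y
  · obtain ⟨x, rfl⟩ := hex
    refine (measureReal_mono fun ω hω => ?_).trans (hN 𝔭 h𝔭 (Ideal.Quotient.mk 𝔭 x))
    refine Ideal.Quotient.eq.2 (hle ?_)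
    have hω : c * N ω = c * x := hω
    simp [mul_sub, hω]
  · have : {ω | c * N ω = y} = ∅ := by
      ext ω
      simpa using fun h => hex ⟨_, h⟩
    rw [this, measureReal_empty]
    exact measureReal_nonneg.trans (hN 𝔭 h𝔭 0)

lemma exists_norm_integral_stdAddChar_le (a : ℕ) [NeZero a] {ε : ℝ} (hε : 0 < ε) :
    ∃ ρ : ℝ, 0 < ρ ∧ ρ < 1 ∧ ∀ {Ω : Type*} [MeasurableSpace Ω] (P : Measure Ω)
      [IsProbabilityMeasure P] (N : Ω → ZMod a), Measurable N → IsBalanced P ε N →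
      ∀ c : ZMod a, c ≠ 0 → ‖∫ ω, ZMod.stdAddChar (c * N ω) ∂P‖ ≤ ρ := by
  obtain ⟨κ, hκ0, hκ⟩ := exists_pos_le_one_sub_re_stdAddChar (a := a)
  -- The `1 / 2` only keeps ρ positive: the square root is 0 once κε ≥ 1.
  refine ⟨max (√(1 - κ * ε)) (1 / 2), by positivity, ?_, ?_⟩
  · refine max_lt ?_ (by norm_num)
    rw [Real.sqrt_lt' one_pos]
    nlinarith
  · intro Ω _ P _ N hNm hN c hc
    refine le_max_of_le_left (Real.le_sqrt_of_sq_le ?_)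
    have hm : Measurable fun ω => c * N ω := by fun_prop
    have := Measure.isProbabilityMeasure_map (μ := P) hm.aemeasurable
    have hint : ∫ ω, ZMod.stdAddChar (c * N ω) ∂P
        = ∑ y, ((P.map fun ω => c * N ω).real {y} : ℂ) * ZMod.stdAddChar y := by
      rw [← integral_map (f := fun y : ZMod a => (ZMod.stdAddChar y : ℂ)) hm.aemeasurable
        (by fun_prop), integral_fintype .of_finite]
      simp
    rw [hint]
    refine sq_norm_sum_stdAddChar_le hκ0 hκ _ (fun _ => measureReal_nonneg) ?_ fun y => ?_
    · rw [sum_measureReal_singleton]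
      simp
    · rw [map_measureReal_apply hm (measurableSet_singleton y)]
      exact measureReal_mul_eq_le hN hc y

end CharacterBound

/-! ### Calculus of exponentially decaying bounds -/

section ExpDecay

/-- The sequence `f` is bounded above by an exponentially decaying sequence. -/
def ExpDecay (f : ℕ → ℝ) : Prop := ∃ K r : ℝ, 0 < K ∧ 0 < r ∧ r < 1 ∧ ∀ n, f n ≤ K * r ^ n

lemma ExpDecay.mono {f g : ℕ → ℝ} (hg : ExpDecay g) (h : ∀ n, f n ≤ g n) : ExpDecay f := by
  obtain ⟨K, r, hK, hr0, hr1, hle⟩ := hg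
  exact ⟨K, r, hK, hr0, hr1, fun n => (h n).trans (hle n)⟩

lemma expDecay_of_eventually {f : ℕ → ℝ} {r : ℝ} (hr0 : 0 < r) (hr1 : r < 1)
    (h : ∀ᶠ n in Filter.atTop, f n ≤ r ^ n) : ExpDecay f := by
  obtain ⟨n₀, h₀⟩ := Filter.eventually_atTop.1 h
  have hnn : 0 ≤ ∑ i ∈ range n₀, |f i| / r ^ i := sum_nonneg fun i _ => by positivity
  refine ⟨1 + ∑ i ∈ range n₀, |f i| / r ^ i, r, by linarith, hr0, hr1, fun n => ?_⟩
  by_cases hn : n₀ ≤ n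
  · refine (h₀ n hn).trans (le_mul_of_one_le_left (by positivity) (by linarith))
  · have h1 : |f n| / r ^ n ≤ ∑ i ∈ range n₀, |f i| / r ^ i :=
      single_le_sum (f := fun i => |f i| / r ^ i) (fun i _ => by positivity)
        (mem_range.2 (not_le.1 hn))
    rw [div_le_iff₀ (by positivity)] at h1
    have : 0 < r ^ n := by positivity
    have := le_abs_self (f n)
    linarith

lemma expDecay_pow {r : ℝ} (hr0 : 0 < r) (hr1 : r < 1) : ExpDecay fun n => r ^ n :=
  expDecay_of_eventually hr0 hr1 (.of_forall fun _ => le_rfl)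

lemma expDecay_zero : ExpDecay fun _ => 0 :=
  expDecay_of_eventually (r := 1 / 2) (by norm_num) (by norm_num)
    (.of_forall fun _ => by positivity)

lemma ExpDecay.add {f g : ℕ → ℝ} (hf : ExpDecay f) (hg : ExpDecay g) :
    ExpDecay fun n => f n + g n := by
  obtain ⟨K, r, hK, hr0, hr1, hle⟩ := hf
  obtain ⟨K', r', hK', hr0', hr1', hle'⟩ := hg
  refine ⟨K + K', max r r', by positivity, by positivity, max_lt hr1 hr1', fun n => ?_⟩
  have h1 : r ^ n ≤ max r r' ^ n := by gcongr; exact le_max_left _ _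
  have h2 : r' ^ n ≤ max r r' ^ n := by gcongr; exact le_max_right _ _
  calc f n + g n ≤ K * r ^ n + K' * r' ^ n := add_le_add (hle n) (hle' n)
    _ ≤ K * max r r' ^ n + K' * max r r' ^ n := by gcongr
    _ = _ := by ring

lemma ExpDecay.sum {ι : Type*} (s : Finset ι) {f : ι → ℕ → ℝ} (h : ∀ i ∈ s, ExpDecay (f i)) :
    ExpDecay fun n => ∑ i ∈ s, f i n := by
  classical
  induction s using Finset.induction_on with
  | empty => simpa using expDecay_zero
  | insert i s hi ih =>
    simp_rw [sum_insert hi]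
    exact (h i (mem_insert_self i s)).add (ih fun j hj => h j (mem_insert_of_mem hj))

lemma ExpDecay.const_mul {f : ℕ → ℝ} (hf : ExpDecay f) {c : ℝ} (hc : 0 ≤ c) :
    ExpDecay fun n => c * f n := by
  obtain ⟨K, r, hK, hr0, hr1, hle⟩ := hf
  refine ⟨(c + 1) * K, r, by positivity, hr0, hr1, fun n => ?_⟩
  have : 0 < r ^ n := by positivity
  calc c * f n ≤ c * (K * r ^ n) := by gcongr; exact hle n
    _ ≤ (c + 1) * (K * r ^ n) := by gcongr; linarith
    _ = _ := by ring

lemma expDecay_mul_pow_pow (M : ℝ) (hM : 0 ≤ M) {t : ℝ} (ht0 : 0 < t) (ht1 : t < 1) :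
    ExpDecay fun n => (M * t ^ n) ^ n := by
  refine expDecay_of_eventually (r := 1 / 2) (by norm_num) (by norm_num) ?_
  have h : Filter.Tendsto (fun n : ℕ => M * t ^ n) Filter.atTop (nhds (M * 0)) :=
    (tendsto_pow_atTop_nhds_zero_of_lt_one ht0.le ht1).const_mul M
  rw [mul_zero] at h
  filter_upwards [h.eventually_le_const (show (0 : ℝ) < 1 / 2 by norm_num)] with n hn
  gcongr

/-- The expression is at most exp(nMtⁿ) - 1 ≤ 2nMtⁿ for large n. Splitting tⁿ = √tⁿ · √tⁿ, one
factor absorbs 2nM and the other is the decay rate. -/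
lemma expDecay_one_add_pow_sub_one (M : ℝ) (hM : 0 ≤ M) {t : ℝ} (ht0 : 0 < t) (ht1 : t < 1) :
    ExpDecay fun n => (1 + M * t ^ n) ^ n - 1 := by
  have hs0 : 0 < √t := Real.sqrt_pos.2 ht0
  have hs1 : √t < 1 := by rwa [Real.sqrt_lt' one_pos, one_pow]
  have hts : t = √t * √t := (Real.mul_self_sqrt ht0.le).symm
  refine expDecay_of_eventually hs0 hs1 ?_
  have h : Filter.Tendsto (fun n : ℕ => (2 * M) * (n * √t ^ n)) Filter.atTop
      (nhds ((2 * M) * 0)) := (tendsto_self_mul_const_pow_of_lt_one hs0.le hs1).const_mul _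
  rw [mul_zero] at h
  filter_upwards [h.eventually_le_const (show (0 : ℝ) < 1 by norm_num)] with n hn
  have hpos : 0 < √t ^ n := by positivity
  have hsn : √t ^ n ≤ 1 := pow_le_one₀ hs0.le hs1.le
  have htn : t ^ n = √t ^ n * √t ^ n := by rw [← mul_pow, ← hts]
  have hy0 : 0 ≤ n * (M * t ^ n) := by positivity
  have hy : 2 * (n * (M * t ^ n)) ≤ √t ^ n := by
    rw [htn]
    calc 2 * (n * (M * (√t ^ n * √t ^ n))) = (2 * M * (n * √t ^ n)) * √t ^ n := by ring
      _ ≤ 1 * √t ^ n := by gcongr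
      _ = _ := one_mul _
  have h1 : (1 + M * t ^ n) ^ n ≤ Real.exp (n * (M * t ^ n)) := by
    rw [Real.exp_nat_mul]
    gcongr
    rw [add_comm]
    exact Real.add_one_le_exp _
  have h2 := Real.abs_exp_sub_one_le (x := n * (M * t ^ n)) (by rw [abs_of_nonneg hy0]; linarith)
  rw [abs_of_nonneg hy0] at h2
  have := le_abs_self (Real.exp (n * (M * t ^ n)) - 1)
  linarith

end ExpDecay

/-! ### Orthogonality in finite quadratic modules -/

section Quadratic

variable {a : ℕ} {V : Type*} [AddCommGroup V] [Module (ZMod a) V]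

/-- Nondegeneracy embeds the orthogonal of `L` into the dual of `V ⧸ L`, by y ↦ B(·, y). -/
lemma card_mul_card_orthogonal_le [NeZero a] [Finite V] (B : V →ₗ[ZMod a] V →ₗ[ZMod a] ZMod a)
    (hB : ∀ y, (∀ x, B x y = 0) → y = 0) (L : Submodule (ZMod a) V) :
    Nat.card L * Nat.card (L.orthogonalBilin B) ≤ Nat.card V := by
  have : Finite (V ⧸ L) := Finite.of_surjective _ L.mkQ_surjective
  rw [Submodule.card_eq_card_quotient_mul_card L, ← card_dual (a := a) (G := V ⧸ L)]
  refine Nat.mul_le_mul_left _ (Nat.card_le_card_of_injective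
    (fun y : L.orthogonalBilin B => L.liftQ (B.flip y) fun x hx => y.2 x hx) fun y y' h => ?_)
  refine Subtype.ext (sub_eq_zero.1 (hB _ fun x => ?_))
  have : B x y = B x y' := LinearMap.congr_fun h (L.mkQ x)
  rw [map_sub, this, sub_self]

variable (Q : QuadraticForm (ZMod a) V)

lemma polarBilin_span_eq_zero {T : Set V} (hT : ∀ x ∈ T, ∀ y ∈ T, Q.polarBilin x y = 0)
    {x y : V} (hx : x ∈ Submodule.span (ZMod a) T) (hy : y ∈ Submodule.span (ZMod a) T) :
    Q.polarBilin x y = 0 := by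
  induction hx, hy using Submodule.span_induction₂ with
  | mem_mem x y hx hy => exact hT x hx y hy
  | zero_left y hy => simp
  | zero_right x hx => simp
  | add_left x y z hx hy hz h1 h2 => rw [map_add, LinearMap.add_apply, h1, h2, add_zero]
  | add_right x y z hx hy hz h1 h2 => rw [map_add, h1, h2, add_zero]
  | smul_left r x y hx hy h => rw [map_smul, LinearMap.smul_apply, h, smul_zero]
  | smul_right r x y hx hy h => rw [map_smul, h, smul_zero]

lemma quadraticForm_span_eq_zero {T : Set V} (hT : ∀ x ∈ T, ∀ y ∈ T, Q.polarBilin x y = 0)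
    (hQ : ∀ x ∈ T, Q x = 0) {x : V} (hx : x ∈ Submodule.span (ZMod a) T) : Q x = 0 := by
  induction hx using Submodule.span_induction with
  | mem x hx => exact hQ x hx
  | zero => exact map_zero Q
  | add x y hx hy h1 h2 =>
    have := polarBilin_span_eq_zero Q hT hx hy
    rw [QuadraticMap.polarBilin_apply_apply, QuadraticMap.polar, h1, h2] at this
    simpa using this
  | smul r x hx h => rw [QuadraticMap.map_smul, h, smul_zero]

lemma card_isotropic_le [NeZero a] [Finite V] (hB : ∀ y, (∀ x, Q.polarBilin x y = 0) → y = 0)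
    {m : ℕ} (hm : Nat.card V = m * m) {L : Submodule (ZMod a) V}
    (hL : ∀ x ∈ L, ∀ y ∈ L, Q.polarBilin x y = 0) :
    Nat.card L ≤ m ∧ (Nat.card L = m → L.orthogonalBilin Q.polarBilin = L) := by
  have hle : L ≤ L.orthogonalBilin Q.polarBilin := fun y hy x hx => hL x hx y hy
  have h1 := card_mul_card_orthogonal_le Q.polarBilin hB L
  have h2 : Nat.card L ≤ Nat.card (L.orthogonalBilin Q.polarBilin) :=
    Nat.card_mono (Set.toFinite _) hle
  rw [hm] at h1
  refine ⟨?_, fun h => ?_⟩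
  · by_contra! h
    exact absurd (h1.trans_lt (Nat.mul_lt_mul_of_lt_of_le h (h.le.trans h2) (by omega)))
      (lt_irrefl _)
  · rw [h] at h1
    have hpos : 0 < m := h ▸ Nat.card_pos
    have h3 := Nat.le_of_mul_le_mul_left h1 hpos
    exact SetLike.coe_injective
      (Set.eq_of_subset_of_ncard_le hle (by
        rw [← h] at h3; exact h3) (Set.toFinite _)).symm

end Quadratic

/-! ### Frequent values and lower bounds for the weight -/

section Weight

variable {V : Type*} {n : ℕ}

/-- The number of times the value `x` occurs in `v`. -/
noncomputable def multiplicity (v : Fin n → V) (x : V) : ℕ :=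
  open Classical in #{i | v i = x}

/-- The values that occur in `v` with frequency at least `1 / k`. -/
noncomputable def frequent [Fintype V] (k : ℕ) (v : Fin n → V) : Finset V :=
  open Classical in {x | n ≤ k * multiplicity v x}

lemma mem_frequent [Fintype V] {k : ℕ} {v : Fin n → V} {x : V} :
    x ∈ frequent k v ↔ n ≤ k * multiplicity v x := by
  simp [frequent]

/-- Each infrequent value occurs fewer than n/k times, and there are at most |V| of them. -/
lemma mul_card_notMem_le [Fintype V] {k : ℕ} {v : Fin n → V} (s : Finset (Fin n))
    (hs : ∀ i ∈ s, v i ∉ frequent k v) : k * #s ≤ Fintype.card V * n := by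
  classical
  have h : #s ≤ ∑ x ∈ (frequent k v)ᶜ, multiplicity v x := by
    rw [card_eq_sum_card_fiberwise (f := v) (t := (frequent k v)ᶜ)
      fun i hi => by simpa using hs i hi]
    refine sum_le_sum fun x _ => card_le_card fun i hi => ?_
    simp only [mem_filter, mem_univ, true_and] at hi ⊢
    exact hi.2
  calc k * #s ≤ k * ∑ x ∈ (frequent k v)ᶜ, multiplicity v x := Nat.mul_le_mul_left _ h
    _ = ∑ x ∈ (frequent k v)ᶜ, k * multiplicity v x := mul_sum _ _ _
    _ ≤ ∑ x ∈ (frequent k v)ᶜ, n := sum_le_sum fun x hx => by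
        rw [mem_compl, mem_frequent] at hx
        omega
    _ ≤ ∑ _x : V, n := sum_le_sum_of_subset (subset_univ _)
    _ = _ := by simp

variable {a : ℕ} [AddCommGroup V] [Module (ZMod a) V] (Q : QuadraticForm (ZMod a) V)

/-- The number of pairs of entries of `v` that are not orthogonal plus the number of
anisotropic entries. -/
def weight (v : Fin n → V) : ℕ :=
  #{p : Fin n × Fin n | Q.polarBilin (v p.1) (v p.2) ≠ 0} + #{i | Q (v i) ≠ 0}

lemma multiplicity_mul_le_weight {v : Fin n → V} {x y : V} (h : Q.polarBilin x y ≠ 0) :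
    multiplicity v x * multiplicity v y ≤ weight Q v := by
  classical
  rw [multiplicity, multiplicity, ← card_product]
  refine le_add_right (card_le_card fun p hp => ?_)
  simp only [mem_product, mem_filter, mem_univ, true_and] at hp ⊢
  rwa [hp.1, hp.2]

lemma multiplicity_le_weight {v : Fin n → V} {x : V} (h : Q x ≠ 0) :
    multiplicity v x ≤ weight Q v := by
  refine le_add_left (card_le_card fun i hi => ?_)
  simp only [mem_filter, mem_univ, true_and] at hi ⊢
  rwa [hi]

lemma sq_le_weight [Fintype V] {k : ℕ} {v : Fin n → V} {x y : V} (hx : x ∈ frequent k v)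
    (hy : y ∈ frequent k v) (h : Q.polarBilin x y ≠ 0) : n * n ≤ k * k * weight Q v := by
  calc n * n ≤ (k * multiplicity v x) * (k * multiplicity v y) :=
        Nat.mul_le_mul (mem_frequent.1 hx) (mem_frequent.1 hy)
    _ = k * k * (multiplicity v x * multiplicity v y) := by ring
    _ ≤ _ := Nat.mul_le_mul_left _ (multiplicity_mul_le_weight Q h)

/-- An entry not orthogonal to a frequent value fails orthogonality with at least n/k positions, and
`weight` counts these pairs row by row. -/
lemma card_mul_le_weight [Fintype V] {k : ℕ} {v : Fin n → V} (s : Finset (Fin n))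
    (hs : ∀ i ∈ s, ∃ x ∈ frequent k v, Q.polarBilin (v i) x ≠ 0) :
    n * #s ≤ k * weight Q v := by
  classical
  have h : ∀ i ∈ s, n ≤ k * #{j | Q.polarBilin (v i) (v j) ≠ 0} := by
    intro i hi
    obtain ⟨x, hx, hne⟩ := hs i hi
    refine (mem_frequent.1 hx).trans (Nat.mul_le_mul_left _ (card_le_card fun j hj => ?_))
    simp only [mem_filter, mem_univ, true_and] at hj ⊢
    rwa [hj]
  have h2 : ∑ i, #{j | Q.polarBilin (v i) (v j) ≠ 0} ≤ weight Q v := by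
    refine le_add_right (le_of_eq ?_)
    simp_rw [card_filter]
    rw [Fintype.sum_prod_type]
  calc n * #s = ∑ _i ∈ s, n := by rw [sum_const, smul_eq_mul, mul_comm]
    _ ≤ ∑ i ∈ s, k * #{j | Q.polarBilin (v i) (v j) ≠ 0} := sum_le_sum h
    _ ≤ ∑ i, k * #{j | Q.polarBilin (v i) (v j) ≠ 0} :=
        sum_le_sum_of_subset (subset_univ s)
    _ = k * ∑ i, #{j | Q.polarBilin (v i) (v j) ≠ 0} := by rw [mul_sum]
    _ ≤ _ := Nat.mul_le_mul_left _ h2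

open scoped Classical in
lemma sum_prod_pow_eq [Fintype V] (L : Submodule (ZMod a) V) (c : ℝ) :
    ∑ v : Fin n → V, c ^ #{i | v i ∉ L}
      = (Nat.card L + ((Fintype.card V : ℝ) - Nat.card L) * c) ^ n := by
  have h1 (v : Fin n → V) : c ^ #{i | v i ∉ L} = ∏ i, if v i ∉ L then c else 1 := by
    rw [prod_ite, prod_const, prod_const_one, mul_one]
  have hc : #{x | x ∈ L} = Nat.card L := by
    rw [Nat.card_eq_fintype_card, ← Fintype.card_subtype]
  have hc' : (#{x | x ∉ L} : ℝ) = Fintype.card V - Nat.card L := by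
    rw [← hc, eq_sub_iff_add_eq, add_comm]
    exact_mod_cast card_filter_add_card_filter_not (s := univ) (fun x => x ∈ L)
  simp_rw [h1]
  rw [← Fintype.sum_pow (fun x => if x ∉ L then c else 1), sum_ite, sum_const, sum_const,
    nsmul_eq_mul, nsmul_eq_mul, hc']
  simp only [not_not, hc]
  ring

open scoped Classical in
lemma card_forall_mem [Fintype V] (L : Submodule (ZMod a) V) :
    #{v : Fin n → V | ∀ i, v i ∈ L} = Nat.card L ^ n := by
  have : ({v : Fin n → V | ∀ i, v i ∈ L} : Finset _)
      = Fintype.piFinset fun _ => ({x | x ∈ L} : Finset V) := by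
    ext v
    simp
  rw [this, Fintype.card_piFinset_const, Nat.card_eq_fintype_card, ← Fintype.card_subtype]

end Weight

/-! ### Exponential decay of the weighted sum -/

section WeightSum

variable {a : ℕ} {V : Type*} [AddCommGroup V] [Module (ZMod a) V]
  (Q : QuadraticForm (ZMod a) V) {n k : ℕ} {σ t : ℝ} [Fintype V]

open scoped Classical in
/-- The sum of `σ ^ weight` over nonisotropic tuples whose set of frequent values is `T`. -/
noncomputable def fiberSum (σ : ℝ) (k n : ℕ) (T : Finset V) : ℝ :=
  ∑ v : Fin n → V with frequent k v = T ∧ weight Q v ≠ 0, σ ^ weight Q v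

lemma fiberSum_le_of_not_orthogonal {T : Finset V} {x y : V} (hx : x ∈ T) (hy : y ∈ T)
    (hxy : Q.polarBilin x y ≠ 0) (ht0 : 0 < t) (ht1 : t < 1) (hσ : σ = t ^ (k * k)) :
    fiberSum Q σ k n T ≤ (Fintype.card V : ℝ) ^ n * t ^ (n * n) := by
  classical
  calc fiberSum Q σ k n T
      ≤ ∑ v : Fin n → V with frequent k v = T ∧ weight Q v ≠ 0, t ^ (n * n) := by
        refine sum_le_sum fun v hv => ?_
        simp only [mem_filter, mem_univ, true_and] at hv
        rw [hσ, ← pow_mul]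
        obtain ⟨rfl, -⟩ := hv
        exact pow_le_pow_of_le_one ht0.le ht1.le (sq_le_weight Q hx hy hxy)
    _ ≤ ∑ _v : Fin n → V, t ^ (n * n) :=
        sum_le_sum_of_subset_of_nonneg (filter_subset _ _) fun _ _ _ => by positivity
    _ = _ := by simp

/-- Here the weight plays no role and the tuples are merely counted: only about |V|n/k entries can
leave the span. -/
lemma fiberSum_le_of_card_lt {T : Finset V} {m : ℕ}
    (hT : Nat.card (Submodule.span (ZMod a) (T : Set V)) < m) (hσ0 : 0 < σ) (hσ1 : σ < 1)
    {μ : ℝ} (hμ1 : 1 < μ) (hμ : 2 * Fintype.card V ≤ μ ^ k) :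
    fiberSum Q σ k n T ≤ (μ ^ Fintype.card V * (m - 1 / 2)) ^ n := by
  classical
  set L := Submodule.span (ZMod a) (T : Set V)
  have hV : (0 : ℝ) < Fintype.card V := by exact_mod_cast Fintype.card_pos
  have hμ0 : 0 < μ := by linarith
  calc fiberSum Q σ k n T
      ≤ ∑ v : Fin n → V with frequent k v = T ∧ weight Q v ≠ 0,
          μ ^ (Fintype.card V * n) * (μ ^ k)⁻¹ ^ #{i | v i ∉ L} := by
        refine sum_le_sum fun v hv => ?_
        simp only [mem_filter, mem_univ, true_and] at hv
        obtain ⟨rfl, -⟩ := hv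
        -- Exponential Markov bound: entries outside `L` are infrequent, so k · #{i | v i ∉ L} ≤
        -- |V|n and the inserted factor is at least 1. It makes the sum a product over coordinates.
        refine (pow_le_one₀ hσ0.le hσ1.le).trans ?_
        rw [inv_pow, ← pow_mul, ← div_eq_mul_inv, one_le_div (by positivity)]
        refine pow_le_pow_right₀ hμ1.le (mul_card_notMem_le (v := v) _ fun i hi => ?_)
        simp only [mem_filter, mem_univ, true_and] at hi
        exact fun h => hi (Submodule.subset_span h)
    _ ≤ ∑ v : Fin n → V, μ ^ (Fintype.card V * n) * (μ ^ k)⁻¹ ^ #{i | v i ∉ L} :=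
        sum_le_sum_of_subset_of_nonneg (filter_subset _ _) fun _ _ _ => by positivity
    _ = (μ ^ Fintype.card V *
          (Nat.card L + ((Fintype.card V : ℝ) - Nat.card L) * (μ ^ k)⁻¹)) ^ n := by
        rw [← mul_sum, sum_prod_pow_eq, mul_pow, pow_mul]
    _ ≤ _ := by
        have h1 : (Nat.card L : ℝ) + 1 ≤ m := by exact_mod_cast hT
        have hLV : (Nat.card L : ℝ) ≤ Fintype.card V := by
          rw [← Nat.card_eq_fintype_card]
          exact_mod_cast Nat.card_le_card_of_injective _ L.subtype_injective
        have h2 : ((Fintype.card V : ℝ) - Nat.card L) * (μ ^ k)⁻¹ ≤ 1 / 2 := by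
          rw [← div_eq_mul_inv, div_le_iff₀ (by positivity)]
          have : (0 : ℝ) ≤ Nat.card L := by positivity
          linarith
        have h3 : 0 ≤ ((Fintype.card V : ℝ) - Nat.card L) * (μ ^ k)⁻¹ :=
          mul_nonneg (by linarith) (by positivity)
        gcongr
        linarith

lemma fiberSum_le_of_orthogonal_eq {T : Finset V} {m : ℕ}
    (hTB : ∀ x ∈ T, ∀ y ∈ T, Q.polarBilin x y = 0)
    (hL : (Submodule.span (ZMod a) (T : Set V)).orthogonalBilin Q.polarBilin
      = Submodule.span (ZMod a) (T : Set V))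
    (hT : Nat.card (Submodule.span (ZMod a) (T : Set V)) = m) (hk : 0 < k)
    (ht0 : 0 < t) (ht1 : t < 1) (hσ : σ = t ^ (k * k)) :
    fiberSum Q σ k n T
      ≤ (m : ℝ) ^ n * t ^ n + (((m : ℝ) + (Fintype.card V - m) * t ^ n) ^ n - (m : ℝ) ^ n) := by
  classical
  set L := Submodule.span (ZMod a) (T : Set V)
  have hσk (w : ℕ) : σ ^ w ≤ t ^ (k * w) := by
    rw [hσ, ← pow_mul]
    refine pow_le_pow_of_le_one ht0.le ht1.le ?_
    rw [mul_assoc]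
    exact Nat.le_mul_of_pos_left _ hk
  have hsum : ∑ v : Fin n → V with ¬ ∀ i, v i ∈ L, (t ^ n) ^ #{i | v i ∉ L}
      = ((m : ℝ) + (Fintype.card V - m) * t ^ n) ^ n - (m : ℝ) ^ n := by
    rw [← hT, ← sum_prod_pow_eq, ← sum_filter_add_sum_filter_not univ (fun v => ∀ i, v i ∈ L),
      eq_sub_iff_add_eq, add_comm]
    congr 1
    rw [← Nat.cast_pow, ← card_forall_mem, ← nsmul_one, ← sum_const]
    refine sum_congr rfl fun v hv => ?_
    simp only [mem_filter, mem_univ, true_and] at hv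
    simp [hv]
  rw [← hsum, fiberSum, ← sum_filter_add_sum_filter_not _ (fun v => ∀ i, v i ∈ L)]
  refine add_le_add ?_ ?_
  · calc _ ≤ ∑ v : Fin n → V with (frequent k v = T ∧ weight Q v ≠ 0) ∧ ∀ i, v i ∈ L, t ^ n := by
          rw [filter_filter]
          refine sum_le_sum fun v hv => ?_
          simp only [mem_filter, mem_univ, true_and] at hv
          obtain ⟨⟨rfl, hw⟩, hvL⟩ := hv
          -- If `Q` vanished at all frequent values, it would vanish on their span `L`, and the
          -- weight would be 0. Orthogonality alone does not suffice, as 2 need not be invertible.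
          obtain ⟨x, hx, hQx⟩ : ∃ x ∈ frequent k v, Q x ≠ 0 := by
            by_contra! h
            refine hw ?_
            simp only [weight, Nat.add_eq_zero_iff, card_eq_zero, filter_eq_empty_iff, mem_univ,
              true_implies, not_not]
            exact ⟨fun p => polarBilin_span_eq_zero Q hTB (hvL _) (hvL _),
              fun i => quadraticForm_span_eq_zero Q hTB h (hvL i)⟩
          exact (hσk _).trans (pow_le_pow_of_le_one ht0.le ht1.le
            ((mem_frequent.1 hx).trans (Nat.mul_le_mul_left _ (multiplicity_le_weight Q hQx))))
      _ ≤ ∑ v : Fin n → V with ∀ i, v i ∈ L, t ^ n :=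
          sum_le_sum_of_subset_of_nonneg
            (fun v hv => mem_filter.2 ⟨mem_univ _, (mem_filter.1 hv).2.2⟩)
            fun _ _ _ => by positivity
      _ = _ := by rw [sum_const, card_forall_mem, nsmul_eq_mul, hT, Nat.cast_pow]
  · rw [filter_filter]
    trans ∑ v : Fin n → V with (frequent k v = T ∧ weight Q v ≠ 0) ∧ ¬ ∀ i, v i ∈ L,
      (t ^ n) ^ #{i | v i ∉ L}
    swap
    · refine sum_le_sum_of_subset_of_nonneg (fun v hv => ?_) fun _ _ _ => ?_
      · simp only [mem_filter, mem_univ, true_and] at hv ⊢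
        exact hv.2
      · exact pow_nonneg (pow_nonneg ht0.le _) _
    refine sum_le_sum fun v hv => ?_
    simp only [mem_filter, mem_univ, true_and] at hv
    obtain ⟨⟨rfl, -⟩, -⟩ := hv
    refine (hσk _).trans ?_
    rw [← pow_mul]
    refine pow_le_pow_of_le_one ht0.le ht1.le (card_mul_le_weight Q _ fun i hi => ?_)
    simp only [mem_filter, mem_univ, true_and] at hi
    -- An entry orthogonal to every frequent value lies in the orthogonal of `L`, which is `L`
    -- itself.
    by_contra! h
    have hmem : L ≤ LinearMap.ker (Q.polarBilin.flip (v i)) := by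
      refine Submodule.span_le.2 fun x hx => ?_
      rw [SetLike.mem_coe, LinearMap.mem_ker, LinearMap.flip_apply,
        QuadraticMap.polarBilin_apply_apply, QuadraticMap.polar_comm]
      exact h x hx
    exact hi (hL.le fun x hx => hmem hx)

lemma exists_one_lt_pow_mul_lt (c : ℕ) (m : ℝ) :
    ∃ μ : ℝ, 1 < μ ∧ μ ^ c * (m - 1 / 2) < m - 1 / 4 := by
  have hcont : Filter.Tendsto (fun μ : ℝ => μ ^ c * (m - 1 / 2)) (nhdsWithin 1 (Set.Ioi 1))
      (nhds (1 ^ c * (m - 1 / 2))) :=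
    (Continuous.tendsto (by fun_prop) 1).mono_left nhdsWithin_le_nhds
  obtain ⟨μ, hμ, hμ1⟩ := ((hcont.eventually_lt_const
    (show 1 ^ c * (m - 1 / 2) < m - 1 / 4 by rw [one_pow]; linarith)).and
      self_mem_nhdsWithin).exists
  exact ⟨μ, hμ1, hμ⟩

theorem expDecay_sum_weight [NeZero a] (hB : ∀ y, (∀ x, Q.polarBilin x y = 0) → y = 0)
    {m : ℕ} (hm : Fintype.card V = m * m) (hσ0 : 0 < σ) (hσ1 : σ < 1) :
    ExpDecay fun n => (∑ v : Fin n → V with weight Q v ≠ 0, σ ^ weight Q v) / (m : ℝ) ^ n := by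
  classical
  have hVpos : 0 < Fintype.card V := Fintype.card_pos
  have hm0 : 0 < m := Nat.pos_of_mul_pos_left (hm ▸ hVpos)
  have hmR : (1 : ℝ) ≤ m := by exact_mod_cast hm0
  have hVR : (Fintype.card V : ℝ) = m * m := by exact_mod_cast hm
  -- The order of choice matters: μ depends on |V| and m, then k on μ, then t on k and σ. The
  -- exponent k² in σ = t^(k²) serves the n²/k² bound in the nonorthogonal case.
  obtain ⟨μ, hμ1, hμ⟩ := exists_one_lt_pow_mul_lt (Fintype.card V) m
  obtain ⟨k, hk⟩ := pow_unbounded_of_one_lt (2 * Fintype.card V : ℝ) hμ1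
  have hk0 : 0 < k := by
    rcases Nat.eq_zero_or_pos k with rfl | h
    · rw [pow_zero, hVR] at hk
      nlinarith
    · exact h
  obtain ⟨t, ht0, ht1, hσ⟩ : ∃ t : ℝ, 0 < t ∧ t < 1 ∧ σ = t ^ (k * k) := by
    have hkk : k * k ≠ 0 := by positivity
    refine ⟨σ ^ (((k * k : ℕ) : ℝ)⁻¹), by positivity,
      Real.rpow_lt_one hσ0.le hσ1 (by positivity), ?_⟩
    rw [Real.rpow_inv_natCast_pow hσ0.le hkk]
  have hfib (n : ℕ) : (∑ v : Fin n → V with weight Q v ≠ 0, σ ^ weight Q v) / (m : ℝ) ^ n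
      = ∑ T : Finset V, fiberSum Q σ k n T / (m : ℝ) ^ n := by
    rw [← sum_div, ← sum_fiberwise _ (frequent k)]
    simp_rw [fiberSum, filter_filter, and_comm]
  simp_rw [hfib]
  refine ExpDecay.sum _ fun T _ => ?_
  by_cases hTB : ∀ x ∈ T, ∀ y ∈ T, Q.polarBilin x y = 0
  · obtain ⟨hle, heq⟩ := card_isotropic_le Q hB (by rwa [Nat.card_eq_fintype_card])
      (L := Submodule.span (ZMod a) (T : Set V))
      fun x hx y hy => polarBilin_span_eq_zero Q hTB hx hy
    rcases hle.lt_or_eq with hlt | hT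
    · have hr : (m - 1 / 4 : ℝ) / m < 1 := by
        rw [div_lt_one (by linarith)]
        linarith
      have hr0 : (0 : ℝ) < (m - 1 / 4 : ℝ) / m := div_pos (by linarith) (by linarith)
      refine (expDecay_pow hr0 hr).mono fun n => ?_
      rw [div_pow]
      have hμ0 : (0 : ℝ) ≤ μ ^ Fintype.card V * (m - 1 / 2) :=
        mul_nonneg (by positivity) (by linarith)
      gcongr
      refine (fiberSum_le_of_card_lt Q hlt hσ0 hσ1 hμ1 hk.le).trans ?_
      gcongr
    · refine ((expDecay_pow ht0 ht1).add (expDecay_one_add_pow_sub_one m (by positivity)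
        ht0 ht1)).mono fun n => ?_
      rw [div_le_iff₀ (by positivity)]
      refine (fiberSum_le_of_orthogonal_eq Q hTB (heq hT) hT hk0 ht0 ht1 hσ).trans ?_
      have h1 : ((m : ℝ) + (Fintype.card V - m) * t ^ n) ^ n
          ≤ (1 + m * t ^ n) ^ n * (m : ℝ) ^ n := by
        rw [← mul_pow, hVR]
        have : 0 < t ^ n := by positivity
        have : 0 ≤ ((m : ℝ) * m - m) * t ^ n := mul_nonneg (by nlinarith) this.le
        gcongr
        nlinarith
      linarith
  · push Not at hTB
    obtain ⟨x, hx, y, hy, hxy⟩ := hTB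
    refine (expDecay_mul_pow_pow m (by positivity) ht0 ht1).mono fun n => ?_
    rw [div_le_iff₀ (by positivity)]
    refine (fiberSum_le_of_not_orthogonal Q hx hy hxy ht0 ht1 hσ).trans (le_of_eq ?_)
    rw [hVR, mul_pow, mul_pow, ← pow_mul]
    ring

end WeightSum

/-! ### Alternating forms and the exterior square -/

section AlternatingForms

variable {a : ℕ} {G : Type*} [AddCommGroup G] {n : ℕ}

lemma alternatingMap_swap (β : G [⋀^Fin 2]→ₗ[ℤ] ZMod a) (x y : G) :
    β ![x, y] + β ![y, x] = 0 := by
  have := β.map_add_swap ![x, y] (show (0 : Fin 2) ≠ 1 by decide)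
  convert this using 3
  funext i
  fin_cases i <;> simp

variable [Module (ZMod a) G]

/-- The tuples of linear forms `D` whose pairing `D j (g i)` with `g` is alternating. -/
def alternatingTuples (g : Fin n → G) : Submodule (ZMod a) (Fin n → Dual (ZMod a) G) where
  carrier := {D | (∀ i, D i (g i) = 0) ∧ ∀ i j, D j (g i) + D i (g j) = 0}
  add_mem' {D E} hD hE := ⟨fun i => by simp [hD.1, hE.1], fun i j => by
    simp only [Pi.add_apply, LinearMap.add_apply]
    linear_combination hD.2 i j + hE.2 i j⟩
  zero_mem' := by simp
  smul_mem' r D hD := ⟨fun i => by simp [hD.1], fun i j => by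
    simp [← mul_add, hD.2]⟩

/-- An alternating form in two variables, from a bilinear map that vanishes on the diagonal. -/
def alternatingMapOfBilin (T : G →ₗ[ZMod a] Dual (ZMod a) G) (hT : ∀ x, T x x = 0) :
    G [⋀^Fin 2]→ₗ[ℤ] ZMod a where
  toFun w := T (w 1) (w 0)
  map_update_add' w i x y := by
    fin_cases i <;> simp
  map_update_smul' w i c x := by
    fin_cases i <;> simp
  map_eq_zero_of_eq' w i j h hij := by
    have : w 0 = w 1 := by
      fin_cases i <;> fin_cases j <;> simp_all
    rw [this, hT]

/-- The tuples `g` and `D` define maps π and τ on Rⁿ. Antisymmetry gives τ(y)(π z) = -τ(z)(π y), so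
τ kills ker π and descends along the surjection π. -/
lemma exists_bilin_of_mem_alternatingTuples {g : Fin n → G}
    (hg : Submodule.span (ZMod a) (Set.range g) = ⊤) {D : Fin n → Dual (ZMod a) G}
    (hD : D ∈ alternatingTuples g) :
    ∃ T : G →ₗ[ZMod a] Dual (ZMod a) G, (∀ x, T x x = 0) ∧ ∀ j, T (g j) = D j := by
  set π := Fintype.linearCombination (ZMod a) g
  have hπ : Function.Surjective π := by
    rw [← LinearMap.range_eq_top, ← hg, Fintype.range_linearCombination]
  set τ := Fintype.linearCombination (ZMod a) D
  have hτ (y z : Fin n → ZMod a) : τ y (π z) + τ z (π y) = 0 := by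
    simp only [τ, π, Fintype.linearCombination_apply, LinearMap.sum_apply, map_sum,
      LinearMap.smul_apply, map_smul, smul_eq_mul]
    simp_rw [mul_sum]
    rw [sum_comm, ← sum_add_distrib]
    refine sum_eq_zero fun i _ => ?_
    rw [← sum_add_distrib]
    refine sum_eq_zero fun j _ => ?_
    linear_combination z j * y i * hD.2 j i
  have hker : LinearMap.ker π ≤ LinearMap.ker τ := by
    intro y hy
    rw [LinearMap.mem_ker] at hy ⊢
    ext x
    obtain ⟨z, rfl⟩ := hπ x
    have := hτ y z
    rwa [hy, map_zero, add_zero] at this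
  let T := (LinearMap.ker π).liftQ τ hker ∘ₗ (π.quotKerEquivOfSurjective hπ).symm.toLinearMap
  have hT (y) : T (π y) = τ y := by
    have : (π.quotKerEquivOfSurjective hπ).symm (π y) = (LinearMap.ker π).mkQ y := by
      rw [LinearEquiv.symm_apply_eq]
      rfl
    simp only [T, LinearMap.comp_apply, LinearEquiv.coe_coe, this]
    rfl
  have hTg (j) : T (g j) = D j := by
    have := hT (Pi.single j 1)
    simpa [π, τ, Fintype.linearCombination_apply_single] using this
  have hanti (x y : G) : T x y + T y x = 0 := by
    obtain ⟨x, rfl⟩ := hπ x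
    obtain ⟨y, rfl⟩ := hπ y
    rw [hT, hT, hτ]
  refine ⟨T, fun x => ?_, hTg⟩
  -- Antisymmetry does not imply T x x = 0 when 2 is not invertible; the diagonal condition on the
  -- generators propagates through the span.
  have hx : x ∈ Submodule.span (ZMod a) (Set.range g) := hg ▸ Submodule.mem_top
  induction hx using Submodule.span_induction with
  | mem x hx =>
    obtain ⟨j, rfl⟩ := hx
    rw [hTg, hD.1]
  | zero => simp
  | add x y _ _ hx hy =>
    simp only [map_add, LinearMap.add_apply]
    linear_combination hx + hy + hanti x y
  | smul r x _ hx => simp [hx]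

/-- The tuple of linear forms `x ↦ β (x, g j)`. -/
def tupleOfAlternatingMap (g : Fin n → G) (β : G [⋀^Fin 2]→ₗ[ℤ] ZMod a) (j : Fin n) :
    Dual (ZMod a) G :=
  AddMonoidHom.toZModLinearMap a (AddMonoidHom.mk' (fun x => β ![x, g j]) fun x y => by
    have := β.map_update_add ![0, g j] 0 x y
    have h (z : G) : Function.update ![0, g j] 0 z = ![z, g j] := by
      funext i
      fin_cases i <;> simp
    rwa [h, h, h] at this)

lemma tupleOfAlternatingMap_apply (g : Fin n → G) (β : G [⋀^Fin 2]→ₗ[ℤ] ZMod a) (j : Fin n)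
    (x : G) : tupleOfAlternatingMap g β j x = β ![x, g j] := rfl

lemma tupleOfAlternatingMap_mem (g : Fin n → G) (β : G [⋀^Fin 2]→ₗ[ℤ] ZMod a) :
    tupleOfAlternatingMap g β ∈ alternatingTuples g := by
  refine ⟨fun i => ?_, fun i j => ?_⟩
  · exact β.map_eq_zero_of_eq _ (i := 0) (j := 1) rfl (by decide)
  · exact alternatingMap_swap β (g i) (g j)

lemma card_alternatingTuples {g : Fin n → G}
    (hg : Submodule.span (ZMod a) (Set.range g) = ⊤) :
    Nat.card (alternatingTuples (a := a) g) = Nat.card (G [⋀^Fin 2]→ₗ[ℤ] ZMod a) := by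
  symm
  refine Nat.card_congr (Equiv.ofBijective
    (fun β : G [⋀^Fin 2]→ₗ[ℤ] ZMod a => ⟨tupleOfAlternatingMap g β, tupleOfAlternatingMap_mem g β⟩) ⟨fun β γ h => ?_, ?_⟩)
  · have hj (j : Fin n) (x : G) : β ![x, g j] = γ ![x, g j] :=
      LinearMap.congr_fun (congr_fun (congr_arg Subtype.val h) j) x
    have hall (x y : G) : β ![x, y] = γ ![x, y] := by
      have hle : Submodule.span (ZMod a) (Set.range g)
          ≤ LinearMap.ker (tupleOfAlternatingMap (fun _ : Fin 1 => x) β 0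
            - tupleOfAlternatingMap (fun _ : Fin 1 => x) γ 0) := by
        refine Submodule.span_le.2 ?_
        rintro _ ⟨j, rfl⟩
        rw [SetLike.mem_coe, LinearMap.mem_ker, LinearMap.sub_apply,
          tupleOfAlternatingMap_apply, tupleOfAlternatingMap_apply]
        linear_combination alternatingMap_swap β (g j) x - alternatingMap_swap γ (g j) x - hj j x
      have hy : y ∈ Submodule.span (ZMod a) (Set.range g) := hg ▸ Submodule.mem_top
      have := hle hy
      rw [LinearMap.mem_ker, LinearMap.sub_apply, tupleOfAlternatingMap_apply,
          tupleOfAlternatingMap_apply] at this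
      linear_combination alternatingMap_swap β x y - alternatingMap_swap γ x y - this
    ext w
    have : w = ![w 0, w 1] := by
      funext i
      fin_cases i <;> rfl
    rw [this, hall]
  · rintro ⟨D, hD⟩
    obtain ⟨T, hT, hTg⟩ := exists_bilin_of_mem_alternatingTuples hg hD
    refine ⟨alternatingMapOfBilin T hT, Subtype.ext (funext fun j => LinearMap.ext fun x => ?_)⟩
    change _ = D j x
    rw [← hTg]
    rfl

/-- Alternating forms are the linear forms on ∧²G, which is finite and killed by `a`, hence has as
many elements as its dual. -/
lemma card_alternatingMap [NeZero a] [Finite G] :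
    Nat.card (G [⋀^Fin 2]→ₗ[ℤ] ZMod a) = Nat.card (⋀[ℤ]^2 G) := by
  have hsmul (x : ⋀[ℤ]^2 G) : (a : ℤ) • x = 0 := by
    have hx : x ∈ Submodule.span ℤ (Set.range (exteriorPower.ιMulti ℤ 2 (M := G))) := by
      rw [exteriorPower.ιMulti_span]
      exact Submodule.mem_top
    induction hx using Submodule.span_induction with
    | mem x hx =>
      obtain ⟨w, rfl⟩ := hx
      have h0 : (a : ℤ) • w 0 = 0 := by
        rw [natCast_zsmul, ZModModule.char_nsmul_eq_zero]
      have := (exteriorPower.ιMulti ℤ 2 (M := G)).map_update_smul w 0 (a : ℤ) (w 0)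
      rw [h0, Function.update_eq_self] at this
      rw [← this]
      exact (exteriorPower.ιMulti ℤ 2 (M := G)).map_coord_zero 0 (by simp)
    | zero => simp
    | add x y _ _ hx hy => rw [smul_add, hx, hy, add_zero]
    | smul r x _ hx => rw [smul_comm, hx, smul_zero]
  have hfin : Finite (⋀[ℤ]^2 G) := Module.finite_of_fg_torsion _ fun {x} =>
    ⟨⟨a, mem_nonZeroDivisors_of_ne_zero (by exact_mod_cast NeZero.ne a)⟩, hsmul x⟩
  let _ : Module (ZMod a) (⋀[ℤ]^2 G) := AddCommGroup.zmodModule fun x => by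
    rw [← natCast_zsmul, hsmul]
  rw [← card_dual (a := a) (G := ⋀[ℤ]^2 G),
    Nat.card_congr (exteriorPower.alternatingMapLinearEquiv (R := ℤ) (M := G) (N := ZMod a)
      (n := 2)).toEquiv]
  exact Nat.card_congr
    { toFun f := f.toAddMonoidHom.toZModLinearMap a
      invFun f := f.toAddMonoidHom.toIntLinearMap
      left_inv _ := rfl
      right_inv _ := rfl }

end AlternatingForms

lemma sum_sum_eq_sum_le {A : Type*} [AddCommMonoid A] {n : ℕ} (f : Fin n → Fin n → A) :
    ∑ i, ∑ j, f i j = ∑ p : {p : Fin n × Fin n // p.1 ≤ p.2},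
      (f p.1.1 p.1.2 + if p.1.1 = p.1.2 then 0 else f p.1.2 p.1.1) := by
  have h : ∑ p : {p : Fin n × Fin n // p.1 ≤ p.2},
      (f p.1.1 p.1.2 + if p.1.1 = p.1.2 then 0 else f p.1.2 p.1.1)
      = ∑ p : Fin n × Fin n, if p.1 ≤ p.2 then
        (f p.1 p.2 + if p.1 = p.2 then 0 else f p.2 p.1) else 0 := by
    rw [← sum_filter]
    exact (sum_subtype _ (by simp) fun p : Fin n × Fin n =>
      f p.1 p.2 + if p.1 = p.2 then 0 else f p.2 p.1).symm
  have h2 : ∑ i, ∑ j, (if i ≤ j then f i j + (if i = j then 0 else f j i) else 0)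
      = ∑ i, ∑ j, ((if i ≤ j then f i j else 0) + if i < j then f j i else 0) := by
    refine sum_congr rfl fun i _ => sum_congr rfl fun j _ => ?_
    rcases lt_trichotomy i j with hij | rfl | hij
    · simp [hij, hij.le, hij.ne]
    · simp
    · simp [hij.not_ge, hij.not_gt]
  rw [h, Fintype.sum_prod_type, h2]
  simp_rw [sum_add_distrib]
  rw [sum_comm (f := fun i j => if i < j then f j i else 0), ← sum_add_distrib]
  refine sum_congr rfl fun i _ => ?_
  rw [← sum_add_distrib]
  refine sum_congr rfl fun j _ => ?_
  by_cases hij : i ≤ j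
  · simp [hij, hij.not_gt]
  · simp [hij, not_le.1 hij]

/-! ### The Fourier pairing in terms of the free entries -/

section Pairing

variable {a : ℕ} {G : Type*} [AddCommGroup G] [Module (ZMod a) G] {n : ℕ}

/-- The images of the columns of `M` under the homomorphism sending the `i`-th basis vector
to `g i`. -/
def columnImages (M : Matrix (Fin n) (Fin n) (ZMod a)) (g : Fin n → G) : Fin n → G :=
  fun j => ∑ i, M i j • g i

/-- The coefficient of the `p`-th entry of a `C`-symmetric matrix in the pairing of `D` with the
images of its columns. -/
def entryCoeff (D : Fin n → Dual (ZMod a) G) (g : Fin n → G)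
    (p : {p : Fin n × Fin n // p.1 ≤ p.2}) : ZMod a :=
  D p.1.2 (g p.1.1) + if p.1.1 = p.1.2 then 0 else D p.1.1 (g p.1.2)

/-- The contribution of `C` to the pairing of `D` with the images of the columns of a
`C`-symmetric matrix. -/
def skewPart (C : Matrix (Fin n) (Fin n) (ZMod a)) (D : Fin n → Dual (ZMod a) G)
    (g : Fin n → G) : ZMod a :=
  ∑ p : {p : Fin n × Fin n // p.1 ≤ p.2},
    if p.1.1 = p.1.2 then 0 else C p.1.1 p.1.2 * D p.1.1 (g p.1.2)

/-- The relation M_ji = M_ij - C_ij eliminates the entries below the diagonal. -/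
lemma sum_apply_columnImages {C M : Matrix (Fin n) (Fin n) (ZMod a)} (hM : IsCSymmetric C M)
    (D : Fin n → Dual (ZMod a) G) (g : Fin n → G) :
    ∑ j, D j (columnImages M g j)
      = -skewPart C D g + ∑ p, entryCoeff D g p * M p.1.1 p.1.2 := by
  simp only [columnImages, map_sum, map_smul, smul_eq_mul]
  rw [sum_comm, sum_sum_eq_sum_le, skewPart, neg_add_eq_sub, ← sum_sub_distrib]
  refine sum_congr rfl fun p _ => ?_
  have : M p.1.1 p.1.2 - M p.1.2 p.1.1 = C p.1.1 p.1.2 := by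
    rw [← hM]
    rfl
  rw [entryCoeff, ← this]
  split_ifs <;> ring

lemma entryCoeff_eq_zero {D : Fin n → Dual (ZMod a) G} {g : Fin n → G}
    (hD : D ∈ alternatingTuples g) (p : {p : Fin n × Fin n // p.1 ≤ p.2}) :
    entryCoeff D g p = 0 := by
  rw [entryCoeff]
  split_ifs with h
  · rw [← h, hD.1, add_zero]
  · exact hD.2 _ _

lemma polarBilin_dualProd (x y : Dual (ZMod a) G × G) :
    (QuadraticForm.dualProd (ZMod a) G).polarBilin x y = x.1 y.2 + y.1 x.2 := by
  simp [QuadraticMap.polar, QuadraticForm.dualProd]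
  ring

lemma weight_eq_zero_iff (D : Fin n → Dual (ZMod a) G) (g : Fin n → G) :
    weight (QuadraticForm.dualProd (ZMod a) G) (fun i => (D i, g i)) = 0
      ↔ D ∈ alternatingTuples g := by
  simp only [weight, Nat.add_eq_zero_iff, card_eq_zero, filter_eq_empty_iff, mem_univ,
    true_implies, not_not, polarBilin_dualProd, Prod.forall]
  rw [and_comm]
  exact and_congr Iff.rfl ⟨fun h i j => h j i, fun h i j => h j i⟩

/-- An off-diagonal coefficient accounts for two ordered pairs; a diagonal one for the pair (i, i),
with value 2D_i(g_i), and for the entry i itself. This factor 2 is why √ρ replaces ρ later. -/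
lemma weight_le_two_mul (D : Fin n → Dual (ZMod a) G) (g : Fin n → G) :
    weight (QuadraticForm.dualProd (ZMod a) G) (fun i => (D i, g i))
      ≤ 2 * #{p | entryCoeff D g p ≠ 0} := by
  have hdiag : #{i | D i (g i) ≠ 0}
      = ∑ i, ∑ j, if i = j then (if D i (g i) ≠ 0 then 1 else 0) else 0 := by
    rw [card_filter]
    simp
  have hpair : #{p : Fin n × Fin n | D p.1 (g p.2) + D p.2 (g p.1) ≠ 0}
      = ∑ i, ∑ j, if D i (g j) + D j (g i) ≠ 0 then 1 else 0 := by
    rw [card_filter, Fintype.sum_prod_type]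
  simp only [weight, polarBilin_dualProd]
  change _ + #{i | D i (g i) ≠ 0} ≤ _
  rw [hdiag, hpair, ← sum_add_distrib]
  simp_rw [← sum_add_distrib]
  rw [sum_sum_eq_sum_le, card_filter, mul_sum]
  refine sum_le_sum fun p _ => ?_
  rw [entryCoeff]
  by_cases h : p.1.1 = p.1.2
  · by_cases h0 : D p.1.2 (g p.1.2) = 0
    · simp [h, h0]
    · simp only [h, h0, if_true, add_zero, ne_eq, not_false_eq_true]
      split_ifs <;> omega
  · simp only [h, Ne.symm h, if_false, add_zero]
    rw [add_comm (D p.1.1 (g p.1.2))]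
    split_ifs <;> omega

/-- The strictly upper triangular part of an alternating matrix `C` is `C`-symmetric. -/
lemma exists_isCSymmetric {C : Matrix (Fin n) (Fin n) (ZMod a)} (hC : IsAlternating C) :
    ∃ M, IsCSymmetric C M := by
  refine ⟨Matrix.of fun i j => if i < j then C i j else 0, ?_⟩
  ext i j
  have h : C j i = -C i j := congr_fun (congr_fun hC.1 i) j
  rcases lt_trichotomy i j with hij | rfl | hij
  · simp [hij, hij.not_gt]
  · simp [hC.2]
  · simp [hij, hij.not_gt, h]

lemma columnImages_sub (M N : Matrix (Fin n) (Fin n) (ZMod a)) (g : Fin n → G) :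
    columnImages (M - N) g = columnImages M g - columnImages N g := by
  ext j
  simp [columnImages, sub_smul]

/-- The images of the columns of symmetric matrices. -/
def symmetricImages (g : Fin n → G) : Submodule (ZMod a) (Fin n → G) where
  carrier := {w | ∃ M : Matrix (Fin n) (Fin n) (ZMod a), M.IsSymm ∧ columnImages M g = w}
  add_mem' := by
    rintro _ _ ⟨M, hM, rfl⟩ ⟨N, hN, rfl⟩
    refine ⟨M + N, hM.add hN, ?_⟩
    ext j
    simp [columnImages, add_smul, sum_add_distrib]
  zero_mem' := ⟨0, Matrix.isSymm_zero, by ext j; simp [columnImages]⟩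
  smul_mem' := by
    rintro r _ ⟨M, hM, rfl⟩
    refine ⟨r • M, hM.smul r, ?_⟩
    ext j
    simp [columnImages, mul_smul, smul_sum]

lemma columnImages_single (i j k : Fin n) (g : Fin n → G) :
    columnImages (Matrix.single i j (1 : ZMod a)) g k = if j = k then g i else 0 := by
  simp [columnImages, Matrix.single, Matrix.of_apply, ite_and]

/-- The `C`-symmetric matrices form a coset of the symmetric ones, so without isotropy the column
images of any of them avoid `symmetricImages g`. A separating linear form on Gⁿ has components `D`;
its vanishing on the images of E_ii and E_ij + E_ji is the alternating condition. -/
lemma exists_mem_alternatingTuples_skewPart_ne_zero [NeZero a] [Finite G]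
    {C : Matrix (Fin n) (Fin n) (ZMod a)} (hC : IsAlternating C) {g : Fin n → G}
    (hg : ¬ ∃ M, IsCSymmetric C M ∧ columnImages M g = 0) :
    ∃ D ∈ alternatingTuples g, skewPart C D g ≠ 0 := by
  obtain ⟨M, hM⟩ := exists_isCSymmetric hC
  have hmem : columnImages M g ∉ symmetricImages (a := a) g := by
    rintro ⟨N, hN, hNM⟩
    refine hg ⟨M - N, ?_, by rw [columnImages_sub, hNM, sub_self]⟩
    rw [IsCSymmetric, Matrix.transpose_sub, hN.eq, ← hM]
    abel
  obtain ⟨f, hf0, hf⟩ := exists_dual_separating (a := a) _ hmem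
  let D : Fin n → Dual (ZMod a) G := fun j => f ∘ₗ LinearMap.single (ZMod a) (fun _ => G) j
  have hD (w : Fin n → G) : f w = ∑ j, D j (w j) := by
    simp only [D, LinearMap.comp_apply, ← map_sum]
    congr 1
    exact (LinearMap.sum_single_apply (fun _ => G) w).symm
  have hDmem : D ∈ alternatingTuples g := by
    constructor
    · intro i
      have := hf0 _ ⟨Matrix.single i i 1, by simp [Matrix.IsSymm], rfl⟩
      simpa [hD, columnImages_single, apply_ite] using this
    · intro i j
      have := hf0 _ ⟨Matrix.single i j 1 + Matrix.single j i 1,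
        by simp [Matrix.IsSymm, add_comm], rfl⟩
      have hadd : columnImages (Matrix.single i j (1 : ZMod a) + Matrix.single j i 1) g
          = columnImages (Matrix.single i j (1 : ZMod a)) g
            + columnImages (Matrix.single j i (1 : ZMod a)) g := by
        ext k
        simp [columnImages, add_smul, sum_add_distrib]
      rw [hadd, map_add, hD, hD] at this
      simpa [columnImages_single, apply_ite] using this
  refine ⟨D, hDmem, fun h => hf ?_⟩
  rw [hD, sum_apply_columnImages hM, h]
  simp [entryCoeff_eq_zero hDmem]

lemma skewPart_eq_zero {C : Matrix (Fin n) (Fin n) (ZMod a)} {g : Fin n → G}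
    (hg : ∃ M, IsCSymmetric C M ∧ columnImages M g = 0) {D : Fin n → Dual (ZMod a) G}
    (hD : D ∈ alternatingTuples g) : skewPart C D g = 0 := by
  obtain ⟨M, hM, h0⟩ := hg
  have := sum_apply_columnImages hM D g
  simpa [h0, entryCoeff_eq_zero hD] using this

lemma skewPart_add (C : Matrix (Fin n) (Fin n) (ZMod a)) (D E : Fin n → Dual (ZMod a) G)
    (g : Fin n → G) : skewPart C (D + E) g = skewPart C D g + skewPart C E g := by
  simp only [skewPart, ← sum_add_distrib]
  refine sum_congr rfl fun p _ => ?_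
  split_ifs
  · simp
  · simp [mul_add]

open scoped Classical in
lemma sum_stdAddChar_skewPart [NeZero a] [Finite G]
    {C : Matrix (Fin n) (Fin n) (ZMod a)} (hC : IsAlternating C) (g : Fin n → G)
    [Fintype (alternatingTuples (a := a) g)] :
    ∑ D : alternatingTuples (a := a) g, ZMod.stdAddChar (-skewPart C D.1 g)
      = if ∃ M, IsCSymmetric C M ∧ columnImages M g = 0
        then (Nat.card (alternatingTuples (a := a) g) : ℂ) else 0 := by
  let χ : AddChar (alternatingTuples (a := a) g) ℂ := ZMod.stdAddChar.compAddMonoidHom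
    (AddMonoidHom.mk' (fun D => -skewPart C D.1 g) fun D E => by
      simp [skewPart_add, add_comm])
  have hχ : χ = 0 ↔ ∃ M, IsCSymmetric C M ∧ columnImages M g = 0 := by
    constructor
    · intro h
      by_contra hg
      obtain ⟨D, hD, hne⟩ := exists_mem_alternatingTuples_skewPart_ne_zero hC hg
      refine hne (neg_eq_zero.1 (ZMod.injective_stdAddChar ?_))
      rw [AddChar.map_zero_eq_one]
      exact DFunLike.congr_fun h (⟨D, hD⟩ : alternatingTuples (a := a) g)
    · intro h
      ext D
      change ZMod.stdAddChar (-skewPart C D.1 g) = 1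
      rw [skewPart_eq_zero h D.2, neg_zero, AddChar.map_zero_eq_one]
  change ∑ D, χ D = _
  rw [AddChar.sum_eq_ite, Nat.card_eq_fintype_card]
  simp only [hχ]

end Pairing

/-! ### From homomorphisms to tuples of generators -/

section Reductions

variable {a : ℕ} {G : Type*} [AddCommGroup G] [Module (ZMod a) G] {n : ℕ}

/-- Homomorphisms out of `Rⁿ` are determined by the images of the basis vectors. -/
def homEquivTuples : ((Fin n → ZMod a) →+ G) ≃ (Fin n → G) where
  toFun F i := F (Pi.single i 1)
  invFun g := (Fintype.linearCombination (ZMod a) g).toAddMonoidHom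
  left_inv F := by
    refine DFunLike.ext _ _ fun x => ?_
    have h : (Fintype.linearCombination (ZMod a) fun i => F (Pi.single i 1))
        = F.toZModLinearMap a := LinearMap.pi_ext' fun i => LinearMap.ext_ring (by
      simp [Fintype.linearCombination_apply_single])
    exact LinearMap.congr_fun h x
  right_inv g := by
    funext i
    simp [Fintype.linearCombination_apply_single]

lemma homEquivTuples_surjective_iff (F : (Fin n → ZMod a) →+ G) :
    Function.Surjective F
      ↔ Submodule.span (ZMod a) (Set.range (homEquivTuples F)) = ⊤ := by
  obtain ⟨g, rfl⟩ := homEquivTuples.symm.surjective F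
  rw [Equiv.apply_symm_apply, ← Fintype.range_linearCombination, LinearMap.range_eq_top]
  rfl

lemma comp_mulVec_eq_zero_iff (M : Matrix (Fin n) (Fin n) (ZMod a)) (F : (Fin n → ZMod a) →+ G) :
    F.comp M.mulVecLin.toAddMonoidHom = 0 ↔ columnImages M (homEquivTuples F) = 0 := by
  have h : homEquivTuples (F.comp M.mulVecLin.toAddMonoidHom)
      = columnImages M (homEquivTuples F) := by
    obtain ⟨g, rfl⟩ := homEquivTuples.symm.surjective F
    rw [Equiv.apply_symm_apply]
    funext j
    simp [homEquivTuples, columnImages, Fintype.linearCombination_apply]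
  rw [← h]
  constructor
  · intro h0
    rw [h0]
    rfl
  · intro h0
    apply homEquivTuples.injective
    rw [h0]
    rfl

lemma numSur_coker (M : Matrix (Fin n) (Fin n) (ZMod a)) :
    numSur (Coker M) G = Nat.card {g : Fin n → G //
      Submodule.span (ZMod a) (Set.range g) = ⊤ ∧ columnImages M g = 0} := by
  let e : (Coker M →+ G) ≃
      {F : (Fin n → ZMod a) →+ G // F.comp M.mulVecLin.toAddMonoidHom = 0} :=
    { toFun f := ⟨f.comp (LinearMap.range M.mulVecLin).mkQ.toAddMonoidHom, by
        refine DFunLike.ext _ _ fun x => ?_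
        have : (LinearMap.range M.mulVecLin).mkQ (M.mulVecLin x) = 0 := by simp
        exact (congr_arg f this).trans (map_zero f)⟩
      invFun F := QuotientAddGroup.lift _ F.1 (by
        rintro _ ⟨x, rfl⟩
        exact DFunLike.congr_fun F.2 x)
      left_inv f := by
        refine DFunLike.ext _ _ fun x => ?_
        obtain ⟨x, rfl⟩ := Submodule.mkQ_surjective _ x
        rfl
      right_inv F := rfl }
  have he (f : Coker M →+ G) : Function.Surjective f ↔ Function.Surjective (e f).1 :=
    ⟨fun h => h.comp (Submodule.mkQ_surjective _), fun h => Function.Surjective.of_comp h⟩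
  let e' : {F : (Fin n → ZMod a) →+ G // F.comp M.mulVecLin.toAddMonoidHom = 0}
      ≃ {g : Fin n → G // columnImages M g = 0} :=
    homEquivTuples.subtypeEquiv (comp_mulVec_eq_zero_iff M)
  refine Nat.card_congr (((e.trans e').subtypeEquiv
    (q := fun g => Submodule.span (ZMod a) (Set.range g.1) = ⊤) fun f => ?_).trans
    ((Equiv.subtypeSubtypeEquivSubtypeInter (fun g => columnImages M g = 0)
      (fun g : Fin n → G => Submodule.span (ZMod a) (Set.range g) = ⊤)).trans
      (Equiv.subtypeEquivRight fun g => and_comm)))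
  rw [he, homEquivTuples_surjective_iff]
  rfl

lemma isIsotropic_iff (C : Matrix (Fin n) (Fin n) (ZMod a)) (F : (Fin n → ZMod a) →+ G) :
    IsIsotropic C F ↔ ∃ M, IsCSymmetric C M ∧ columnImages M (homEquivTuples F) = 0 :=
  exists_congr fun M => and_congr_right fun _ => comp_mulVec_eq_zero_iff M F

open scoped Classical in
lemma probIsotropic_eq [Fintype G] (C : Matrix (Fin n) (Fin n) (ZMod a)) :
    probIsotropic G C
      = #{g : Fin n → G | ∃ M, IsCSymmetric C M ∧ columnImages M g = 0}
        / (Nat.card G : ℝ) ^ n := by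
  let _ : MeasurableSpace ((Fin n → ZMod a) →+ G) := ⊤
  let _ : Fintype ((Fin n → ZMod a) →+ G) := Fintype.ofEquiv _ homEquivTuples.symm
  have hcard : Fintype.card ((Fin n → ZMod a) →+ G) = Nat.card G ^ n := by
    rw [Fintype.card_congr homEquivTuples, Fintype.card_fun, Nat.card_eq_fintype_card,
      Fintype.card_fin]
  have hset : #{F : (Fin n → ZMod a) →+ G | IsIsotropic C F}
      = #{g : Fin n → G | ∃ M, IsCSymmetric C M ∧ columnImages M g = 0} :=
    card_equiv homEquivTuples fun F => by simp [isIsotropic_iff]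
  rw [probIsotropic, uniformHom, measureReal_def, uniformOn_univ, hcard, ← hset,
    Measure.count_apply (MeasurableSpace.measurableSet_top), ENNReal.toReal_div,
    Set.encard_eq_coe_toFinset_card]
  simp

open scoped Classical in
-- Union bound over the finitely many proper submodules `H`, each containing a proportion (|H|/|G|)ⁿ
-- of the tuples.
lemma expDecay_card_span_ne_top (a : ℕ) (G : Type*) [AddCommGroup G] [Module (ZMod a) G]
    [Fintype G] :
    ExpDecay fun n => (#{g : Fin n → G | Submodule.span (ZMod a) (Set.range g) ≠ ⊤} : ℝ)
      / (Nat.card G : ℝ) ^ n := by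
  let _ : Fintype (Submodule (ZMod a) G) := Fintype.ofFinite _
  have hG : (0 : ℝ) < Nat.card G := by exact_mod_cast Nat.card_pos
  have hdec : ExpDecay fun n => ∑ H : Submodule (ZMod a) G with H ≠ ⊤,
      ((Nat.card H : ℝ) / Nat.card G) ^ n := by
    refine ExpDecay.sum _ fun H hH => ?_
    have hH' : H ≠ ⊤ := (mem_filter.1 hH).2
    have hHpos : (0 : ℝ) < Nat.card H := by exact_mod_cast Nat.card_pos
    refine expDecay_pow (by positivity) ((div_lt_one hG).2 ?_)
    have := Set.ncard_lt_ncard (s := (H : Set G)) (t := Set.univ)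
      (Set.ssubset_univ_iff.2 fun h => hH' (SetLike.coe_injective h))
    rw [Set.ncard_univ] at this
    exact_mod_cast this
  refine hdec.mono fun n => ?_
  simp_rw [div_pow]
  rw [← sum_div]
  gcongr
  simp_rw [← Nat.cast_pow, ← card_forall_mem]
  rw [← Nat.cast_sum, Nat.cast_le]
  refine le_trans (card_le_card (t := (univ.filter fun H : Submodule (ZMod a) G => H ≠ ⊤).biUnion
    fun H => ({v : Fin n → G | ∀ i, v i ∈ H} : Finset _)) fun g hg => ?_) card_biUnion_le
  simp only [mem_filter, mem_univ, true_and, mem_biUnion] at hg ⊢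
  exact ⟨_, hg, fun i => Submodule.subset_span ⟨i, rfl⟩⟩

end Reductions

/-! ### Computation of the expected number of surjections -/

section Expectation

variable {a : ℕ} [NeZero a] {G : Type*} [AddCommGroup G] [Module (ZMod a) G] {n : ℕ}
  {C : Matrix (Fin n) (Fin n) (ZMod a)} {Ω : Type*} [MeasurableSpace Ω] {P : Measure Ω}
  {X : Ω → Matrix (Fin n) (Fin n) (ZMod a)}

lemma polarBilin_dualProd_nondegenerate [Finite G] (y : Dual (ZMod a) G × G)
    (hy : ∀ x, (QuadraticForm.dualProd (ZMod a) G).polarBilin x y = 0) : y = 0 := by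
  simp only [polarBilin_dualProd] at hy
  refine Prod.ext (LinearMap.ext fun x => by simpa using hy (0, x)) ?_
  by_contra h
  obtain ⟨f, hf⟩ := exists_dual_ne_zero (a := a) h
  exact hf (by simpa using hy (f, 0))

lemma measurable_matrix_comp (hX : ∀ i j, Measurable fun ω => X ω i j)
    (f : Matrix (Fin n) (Fin n) (ZMod a) → ℂ) : Measurable fun ω => f (X ω) := by
  let _ : MeasurableSpace (Matrix (Fin n) (Fin n) (ZMod a)) := MeasurableSpace.pi
  have hXm : Measurable X := measurable_pi_iff.2 fun i => measurable_pi_iff.2 fun j => hX i j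
  have : DiscreteMeasurableSpace (Matrix (Fin n) (Fin n) (ZMod a)) :=
    inferInstanceAs (DiscreteMeasurableSpace (Fin n → Fin n → ZMod a))
  exact (Measurable.of_discrete (f := f)).comp hXm

lemma integral_stdAddChar_columnImages (hX : ∀ i j, Measurable fun ω => X ω i j)
    (hC : ∀ᵐ ω ∂P, IsCSymmetric C (X ω))
    (hind : iIndepFun (fun (p : {p : Fin n × Fin n // p.1 ≤ p.2}) ω => X ω p.1.1 p.1.2) P)
    (D : Fin n → Dual (ZMod a) G) (g : Fin n → G) :
    ∫ ω, ZMod.stdAddChar (∑ j, D j (columnImages (X ω) g j)) ∂P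
      = ZMod.stdAddChar (-skewPart C D g)
        * ∏ p, ∫ ω, ZMod.stdAddChar (entryCoeff D g p * X ω p.1.1 p.1.2) ∂P := by
  rw [← iIndepFun.integral_fun_prod_comp (𝓧 := fun _ => ZMod a)
    (f := fun p x => (ZMod.stdAddChar (entryCoeff D g p * x) : ℂ)) hind
    (fun p => (hX _ _).aemeasurable)
    (fun p => (measurable_of_finite _).aestronglyMeasurable), ← integral_const_mul]
  refine integral_congr_ae ?_
  filter_upwards [hC] with ω hω
  rw [sum_apply_columnImages hω, AddChar.map_add_eq_mul, addChar_sum]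

variable [IsProbabilityMeasure P]

lemma norm_integral_stdAddChar_columnImages_le (hX : ∀ i j, Measurable fun ω => X ω i j)
    (hC : ∀ᵐ ω ∂P, IsCSymmetric C (X ω))
    (hind : iIndepFun (fun (p : {p : Fin n × Fin n // p.1 ≤ p.2}) ω => X ω p.1.1 p.1.2) P)
    {ρ : ℝ} (hρ0 : 0 < ρ) (hρ1 : ρ < 1)
    (hρ : ∀ i j, i ≤ j → ∀ c : ZMod a, c ≠ 0 →
      ‖∫ ω, ZMod.stdAddChar (c * X ω i j) ∂P‖ ≤ ρ)
    (D : Fin n → Dual (ZMod a) G) (g : Fin n → G) :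
    ‖∫ ω, ZMod.stdAddChar (∑ j, D j (columnImages (X ω) g j)) ∂P‖
      ≤ √ρ ^ weight (QuadraticForm.dualProd (ZMod a) G) (fun i => (D i, g i)) := by
  classical
  have h1 : √ρ ≤ 1 := Real.sqrt_le_one.2 hρ1.le
  rw [integral_stdAddChar_columnImages hX hC hind, norm_mul, AddChar.norm_apply, one_mul,
    norm_prod]
  calc ∏ p, ‖∫ ω, ZMod.stdAddChar (entryCoeff D g p * X ω p.1.1 p.1.2) ∂P‖
      ≤ ∏ p, if entryCoeff D g p ≠ 0 then ρ else 1 := by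
        refine prod_le_prod (fun _ _ => norm_nonneg _) fun p _ => ?_
        split_ifs with h
        · exact hρ _ _ p.2 _ h
        · rw [not_not.1 h]
          simp
    _ = √ρ ^ (2 * #{p | entryCoeff D g p ≠ 0}) := by
        rw [prod_ite, prod_const, prod_const_one, mul_one, pow_mul, Real.sq_sqrt hρ0.le]
    _ ≤ _ := pow_le_pow_of_le_one (Real.sqrt_nonneg _) h1 (weight_le_two_mul D g)

open scoped Classical in
lemma norm_integral_columnImages_eq_zero_sub_le [Finite G]
    [Fintype (Dual (ZMod a) G)] (hCalt : IsAlternating C)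
    (hX : ∀ i j, Measurable fun ω => X ω i j)
    (hC : ∀ᵐ ω ∂P, IsCSymmetric C (X ω))
    (hind : iIndepFun (fun (p : {p : Fin n × Fin n // p.1 ≤ p.2}) ω => X ω p.1.1 p.1.2) P)
    {ρ : ℝ} (hρ0 : 0 < ρ) (hρ1 : ρ < 1)
    (hρ : ∀ i j, i ≤ j → ∀ c : ZMod a, c ≠ 0 →
      ‖∫ ω, ZMod.stdAddChar (c * X ω i j) ∂P‖ ≤ ρ)
    (g : Fin n → G) :
    ‖(∫ ω, (if columnImages (X ω) g = 0 then 1 else 0 : ℂ) ∂P)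
      - (if ∃ M, IsCSymmetric C M ∧ columnImages M g = 0
          then (Nat.card (alternatingTuples (a := a) g) : ℂ) else 0) / (Nat.card G : ℂ) ^ n‖
    ≤ (∑ D : Fin n → Dual (ZMod a) G with
        weight (QuadraticForm.dualProd (ZMod a) G) (fun i => (D i, g i)) ≠ 0,
          √ρ ^ weight (QuadraticForm.dualProd (ZMod a) G) (fun i => (D i, g i)))
        / (Nat.card G : ℝ) ^ n := by
  have hG : (Nat.card G : ℂ) ^ n ≠ 0 := pow_ne_zero _ (Nat.cast_ne_zero.2 Nat.card_pos.ne')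
  have hmeas (D : Fin n → Dual (ZMod a) G) :
      Measurable fun ω => (ZMod.stdAddChar (∑ j, D j (columnImages (X ω) g j)) : ℂ) :=
    measurable_matrix_comp hX fun M => ZMod.stdAddChar (∑ j, D j (columnImages M g j))
  have hint : ∫ ω, (if columnImages (X ω) g = 0 then 1 else 0 : ℂ) ∂P
      = (∑ D : Fin n → Dual (ZMod a) G,
          ∫ ω, ZMod.stdAddChar (∑ j, D j (columnImages (X ω) g j)) ∂P) / (Nat.card G : ℂ) ^ n := by
    rw [← integral_finsetSum _ fun D _ => Integrable.of_bound (hmeas D).aestronglyMeasurable 1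
      (.of_forall fun ω => (AddChar.norm_apply _ _).le), ← integral_div]
    congr 1
    funext ω
    rw [sum_stdAddChar_dual_pi]
    split_ifs
    · rw [div_self hG]
    · rw [zero_div]
  -- Weight 0 means that every coefficient of a random entry vanishes, so these terms are
  -- deterministic and give the exact main term.
  have hmain : ∑ D : Fin n → Dual (ZMod a) G with
        weight (QuadraticForm.dualProd (ZMod a) G) (fun i => (D i, g i)) = 0,
          ∫ ω, ZMod.stdAddChar (∑ j, D j (columnImages (X ω) g j)) ∂P
      = if ∃ M, IsCSymmetric C M ∧ columnImages M g = 0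
          then (Nat.card (alternatingTuples (a := a) g) : ℂ) else 0 := by
    rw [← sum_stdAddChar_skewPart hCalt,
      sum_subtype (p := fun D => D ∈ alternatingTuples (a := a) g) _
        (fun D => by simp [weight_eq_zero_iff])]
    refine sum_congr rfl fun D _ => ?_
    rw [integral_stdAddChar_columnImages hX hC hind]
    simp [entryCoeff_eq_zero D.2]
  rw [hint, ← hmain, ← sum_filter_add_sum_filter_not univ (fun D : Fin n → Dual (ZMod a) G =>
    weight (QuadraticForm.dualProd (ZMod a) G) (fun i => (D i, g i)) = 0), ← sub_div,
    add_sub_cancel_left, norm_div, norm_pow, Complex.norm_natCast]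
  gcongr
  exact (norm_sum_le _ _).trans (sum_le_sum fun D _ =>
    norm_integral_stdAddChar_columnImages_le hX hC hind hρ0 hρ1 hρ D g)

open scoped Classical in
lemma abs_integral_numSur_sub_le [Fintype G]
    [Fintype (Dual (ZMod a) G)] (hCalt : IsAlternating C)
    (hX : ∀ i j, Measurable fun ω => X ω i j)
    (hC : ∀ᵐ ω ∂P, IsCSymmetric C (X ω))
    (hind : iIndepFun (fun (p : {p : Fin n × Fin n // p.1 ≤ p.2}) ω => X ω p.1.1 p.1.2) P)
    {ρ : ℝ} (hρ0 : 0 < ρ) (hρ1 : ρ < 1)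
    (hρ : ∀ i j, i ≤ j → ∀ c : ZMod a, c ≠ 0 →
      ‖∫ ω, ZMod.stdAddChar (c * X ω i j) ∂P‖ ≤ ρ) :
    |∫ ω, (numSur (Coker (X ω)) G : ℝ) ∂P - (Nat.card (⋀[ℤ]^2 G) : ℝ) * probIsotropic G C|
      ≤ (∑ v : Fin n → Dual (ZMod a) G × G with
          weight (QuadraticForm.dualProd (ZMod a) G) v ≠ 0,
            √ρ ^ weight (QuadraticForm.dualProd (ZMod a) G) v) / (Nat.card G : ℝ) ^ n
        + (Nat.card (⋀[ℤ]^2 G) : ℝ)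
          * (#{g : Fin n → G | Submodule.span (ZMod a) (Set.range g) ≠ ⊤}
            / (Nat.card G : ℝ) ^ n) := by
  set W : ℝ := ((Nat.card (⋀[ℤ]^2 G) : ℕ) : ℝ) with hW
  set m : ℝ := ((Nat.card G : ℕ) : ℝ) with hm
  have hm0 : 0 < m := Nat.cast_pos.2 Nat.card_pos
  let iso (g : Fin n → G) : Prop := ∃ M, IsCSymmetric C M ∧ columnImages M g = 0
  let S : Finset (Fin n → G) := {g | Submodule.span (ZMod a) (Set.range g) = ⊤}
  have hmeas (g : Fin n → G) :
      Measurable fun ω => (if columnImages (X ω) g = 0 then 1 else 0 : ℂ) :=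
    measurable_matrix_comp hX fun M => if columnImages M g = 0 then 1 else 0
  have hnum : ((∫ ω, (numSur (Coker (X ω)) G : ℝ) ∂P : ℝ) : ℂ)
      = ∑ g ∈ S, ∫ ω, (if columnImages (X ω) g = 0 then 1 else 0 : ℂ) ∂P := by
    rw [← integral_finsetSum _ fun g _ => Integrable.of_bound (hmeas g).aestronglyMeasurable 1
      (.of_forall fun ω => by split_ifs <;> simp), ← integral_complex_ofReal]
    congr 1
    funext ω
    rw [numSur_coker, Nat.card_eq_fintype_card, Fintype.card_subtype, ← filter_filter, sum_boole]
    simp [S]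
  have hiso : W * probIsotropic G C
      = (∑ g ∈ S, (if iso g then W else 0) / m ^ n)
        + ∑ g ∈ Sᶜ, (if iso g then W else 0) / m ^ n := by
    rw [sum_add_sum_compl, probIsotropic_eq, ← sum_div, ← sum_filter, sum_const, nsmul_eq_mul]
    rw [mul_div_assoc', mul_comm W]
    congr!
  have hrest0 : 0 ≤ ∑ g ∈ Sᶜ, (if iso g then W else 0) / m ^ n :=
    sum_nonneg fun g _ => by split_ifs <;> positivity
  have hrest : ∑ g ∈ Sᶜ, (if iso g then W else 0) / m ^ n
      ≤ W * (#{g : Fin n → G | Submodule.span (ZMod a) (Set.range g) ≠ ⊤} / m ^ n) := by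
    have hS : Sᶜ = ({g : Fin n → G | Submodule.span (ZMod a) (Set.range g) ≠ ⊤} : Finset _) := by
      ext g
      simp [S]
    rw [hS]
    refine (sum_le_sum (g := fun _ => W / m ^ n) fun g _ => ?_).trans (le_of_eq ?_)
    · gcongr
      split_ifs
      · exact le_rfl
      · positivity
    · rw [sum_const, nsmul_eq_mul]
      ring
  have hmainterm : ‖((∫ ω, (numSur (Coker (X ω)) G : ℝ) ∂P
        - ∑ g ∈ S, (if iso g then W else 0) / m ^ n : ℝ) : ℂ)‖
      ≤ (∑ v : Fin n → Dual (ZMod a) G × G with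
          weight (QuadraticForm.dualProd (ZMod a) G) v ≠ 0,
            √ρ ^ weight (QuadraticForm.dualProd (ZMod a) G) v) / m ^ n := by
    rw [Complex.ofReal_sub, hnum, Complex.ofReal_sum, ← sum_sub_distrib]
    refine (norm_sum_le _ _).trans ?_
    trans ∑ g ∈ S, (∑ D : Fin n → Dual (ZMod a) G with
        weight (QuadraticForm.dualProd (ZMod a) G) (fun i => (D i, g i)) ≠ 0,
          √ρ ^ weight (QuadraticForm.dualProd (ZMod a) G) (fun i => (D i, g i))) / m ^ n
    · refine sum_le_sum fun g hg => ?_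
      have hg' : Submodule.span (ZMod a) (Set.range g) = ⊤ := (mem_filter.1 hg).2
      have := norm_integral_columnImages_eq_zero_sub_le hCalt hX hC hind hρ0 hρ1 hρ g
      rw [card_alternatingTuples hg', card_alternatingMap] at this
      have heq : (((if iso g then W else 0) / m ^ n : ℝ) : ℂ)
          = (if ∃ M, IsCSymmetric C M ∧ columnImages M g = 0
              then (Nat.card (⋀[ℤ]^2 G) : ℂ) else 0) / (Nat.card G : ℂ) ^ n := by
        simp only [iso, hW, hm]
        split_ifs <;> simp
      rw [heq]
      exact this
    -- Surjectivity is dropped in the error, so that the pairs (D, g) run over all tuples in G^∨ ×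
    -- G.
    · refine (sum_le_sum_of_subset_of_nonneg (subset_univ S)
        fun g _ _ => by positivity).trans (le_of_eq ?_)
      rw [← sum_div]
      congr 1
      simp_rw [sum_filter]
      rw [sum_comm, ← Fintype.sum_prod_type',
        ← Equiv.sum_comp (Equiv.arrowProdEquivProdArrow (Fin n) (fun _ => Dual (ZMod a) G)
          (fun _ => G))]
      rfl
  rw [Complex.norm_real, Real.norm_eq_abs] at hmainterm
  rw [hiso, ← sub_sub]
  refine (abs_sub _ _).trans (add_le_add hmainterm ?_)
  rwa [abs_of_nonneg hrest0]

/-- Both error terms depend only on `a`, `G`, ρ and n, so the constants precede `C`, `P` and `X`. -/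
lemma exists_abs_integral_numSur_sub_le [Finite G] {ρ : ℝ} (hρ0 : 0 < ρ) (hρ1 : ρ < 1) :
    ∃ K r : ℝ, 0 < K ∧ 0 < r ∧ r < 1 ∧ ∀ {n : ℕ} {C : Matrix (Fin n) (Fin n) (ZMod a)}
      (_ : IsAlternating C) {Ω : Type*} [MeasurableSpace Ω] {P : Measure Ω}
      [IsProbabilityMeasure P] {X : Ω → Matrix (Fin n) (Fin n) (ZMod a)}
      (_ : ∀ i j, Measurable fun ω => X ω i j) (_ : ∀ᵐ ω ∂P, IsCSymmetric C (X ω))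
      (_ : iIndepFun (fun (p : {p : Fin n × Fin n // p.1 ≤ p.2}) ω => X ω p.1.1 p.1.2) P)
      (_ : ∀ i j, i ≤ j → ∀ c : ZMod a, c ≠ 0 →
        ‖∫ ω, ZMod.stdAddChar (c * X ω i j) ∂P‖ ≤ ρ),
      |∫ ω, (numSur (Coker (X ω)) G : ℝ) ∂P - (Nat.card (⋀[ℤ]^2 G) : ℝ) * probIsotropic G C|
        ≤ K * r ^ n := by
  classical
  cases nonempty_fintype G
  cases nonempty_fintype (Dual (ZMod a) G)
  have hcard : Fintype.card (Dual (ZMod a) G × G) = Nat.card G * Nat.card G := by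
    rw [Fintype.card_prod, ← Nat.card_eq_fintype_card, ← Nat.card_eq_fintype_card, card_dual]
  obtain ⟨K, r, hK, hr0, hr1, hle⟩ := (expDecay_sum_weight
    (QuadraticForm.dualProd (ZMod a) G) polarBilin_dualProd_nondegenerate hcard
    (Real.sqrt_pos.2 hρ0) (by rwa [Real.sqrt_lt' one_pos, one_pow])).add
    ((expDecay_card_span_ne_top a G).const_mul (Nat.cast_nonneg (Nat.card (⋀[ℤ]^2 G))))
  exact ⟨K, r, hK, hr0, hr1, fun hCalt _ _ _ _ _ hX hC hind hρ =>
    (abs_integral_numSur_sub_le hCalt hX hC hind hρ0 hρ1 hρ).trans (hle _)⟩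

end Expectation

end RandomCokernel

theorem mainTheorem5 (a : ℕ) (ha : 0 < a) (G : Type*) [AddCommGroup G] [Finite G]
    (hG : AddMonoid.exponent G ∣ a) (ε : ℝ) (hε : 0 < ε) :
    ∃ K > (0 : ℝ), ∃ c > (0 : ℝ),
      ∀ (n : ℕ) (C : Matrix (Fin n) (Fin n) (ZMod a)), RandomCokernel.IsAlternating C →
      ∀ (Ω : Type*) [MeasurableSpace Ω] (P : Measure Ω) [IsProbabilityMeasure P]
        (X : Ω → Matrix (Fin n) (Fin n) (ZMod a)),
        (∀ i j, Measurable fun ω => X ω i j) →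
        (∀ᵐ ω ∂P, RandomCokernel.IsCSymmetric C (X ω)) →
        iIndepFun (fun (p : {p : Fin n × Fin n // p.1 ≤ p.2}) ω => X ω p.1.1 p.1.2) P →
        (∀ i j, i ≤ j → RandomCokernel.IsBalanced P ε fun ω => X ω i j) →
        |∫ ω, (RandomCokernel.numSur (RandomCokernel.Coker (X ω)) G : ℝ) ∂P
            - (Nat.card (⋀[ℤ]^2 G) : ℝ) * RandomCokernel.probIsotropic G C|
          ≤ K * Real.exp (-c * n) := by
  classical
  have : NeZero a := ⟨ha.ne'⟩
  let _ : Module (ZMod a) G := AddCommGroup.zmodModule fun x =>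
    AddMonoid.exponent_dvd_iff_forall_nsmul_eq_zero.1 hG x
  obtain ⟨ρ, hρ0, hρ1, hρ⟩ := RandomCokernel.exists_norm_integral_stdAddChar_le a hε
  obtain ⟨K, r, hK, hr0, hr1, hle⟩ :=
    RandomCokernel.exists_abs_integral_numSur_sub_le (a := a) (G := G) hρ0 hρ1
  refine ⟨K, hK, -Real.log r, neg_pos.2 (Real.log_neg hr0 hr1), ?_⟩
  intro n C hCalt Ω _ P _ X hX hC hind hbal
  rw [neg_neg, mul_comm (Real.log r), Real.exp_nat_mul, Real.exp_log hr0]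
  exact hle hCalt hX hC hind fun i j hij c hc => hρ P _ (hX i j) (hbal i j hij) c hc
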